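/- Let $T=[x_0,x_1,x_2,x_3]\subset\mathbb R^3$ be a nondegenerate tetrahedron, let $z$ be any point in the interior of $T$, and let $T^{\mathrm A}=\{T_0,T_1,T_2,T_3\}$ be the corresponding Alfeld split, where $T_i$ is the tetrahedron obtained from $T$ by replacing the vertex $x_i$ by $z$. Let $\mathbb S$ be the space of real symmetric $3\times3$ matrices, and let $$\Sigma_h(T)=\{\omega\in H(\operatorname{div},T,\mathbb S):\ \omega|_K\in\mathcal P_1(K,\mathbb S)\ \text{for all }K\in T^{\mathrm A}\},$$ where $H(\operatorname{div},T,\mathbb S)$ consists of the $\omega\in L^2(T,\mathbb S)$ whose row-wise distributional divergence lies in $L^2(T,\mathbb R^3)$ and $\mathcal P_1$ denotes polynomials of degree at most $1$. Let $W_h(T)$ be the space of vector fields in $L^2(T,\mathbb R^3)$ that are constant on each $K\in T^{\mathrm A}$, let $P_T:L^2(T,\mathbb R^3)\to W_h(T)$ be the $L^2(T)$-orthogonal projection, and let $\mathcal R(T)=\{x\mapsto a+b\times x:\ a,b\in\mathbb R^3\}$ be the space of rigid displacements on $T$. On a facet $F$ of $T$ with outward unit normal $n$ put $\omega_{nn}=\omega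 n\cdot n$ and $\omega_{nt}=n\times(\omega n\times n)$, and let $\mathcal R(F)=\{x\mapsto a+\beta\, n\times x:\ a\in\mathbb R^3,\ a\cdot n=0,\ \beta\in\mathbb R\}$ be the space of (tangential) rigid motions of $F$. Define the reduced stress space $$\Sigma_h^R(T)=\{\omega\in\Sigma_h(T):\ \operatorname{div}\omega\in P_T\mathcal R(T),\ \ \omega_{nt}|_F\in\mathcal R(F)\ \text{for all facets }F\text{ of }T\}.$$ Then $\dim\Sigma_h^R(T)=24$, and an element $\omega\in\Sigma_h^R(T)$ is uniquely determined by the degrees of freedom $$\int_F\omega_{nn}\,\kappa\,ds,\quad \kappa\in\mathcal P_1(F),\ F\text{ a facet of }T\quad(12\text{ dofs}),$$ $$\int_F\omega_{nt}\cdot\kappa\,ds,\quad \kappa\in\mathcal R(F),\ F\text{ a facet of }T\quad(12\text{ dofs}).$$ That is: $\dim\mathcal P_1(F)=\dim\mathcal R(F)=3$ for each of the four facets $F$; two elements of $\Sigma_h^R(T)$ for which all these degrees of freedom agree are equal; and for arbitrary linear functionals $f_F$ on $\mathcal P_1(F)$ and $g_F$ on $\mathcal R(F)$, one pair for each facet $F$,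 there is an $\omega\in\Sigma_h^R(T)$ with $\int_F\omega_{nn}\kappa\,ds=f_F(\kappa)$ for all $\kappa\in\mathcal P_1(F)$ and $\int_F\omega_{nt}\cdot\kappa\,ds=g_F(\kappa)$ for all $\kappa\in\mathcal R(F)$, for every facet $F$. -/

import Mathlib

open MeasureTheory

noncomputable section

namespace JKM

/-- Three-dimensional vectors, with the Euclidean norm. -/
abbrev Vec : Type := EuclideanSpace ℝ (Fin 3)

/-- Real `3 × 3` matrices. -/
abbrev Mat : Type := Matrix (Fin 3) (Fin 3) ℝ

/-- The cross product of two vectors. -/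
def cross (a b : Vec) : Vec := WithLp.toLp 2 (crossProduct a.ofLp b.ofLp)

/-- A (nondegenerate) tetrahedron `[x₀, x₁, x₂, x₃]` together with the interior point `z` that
defines its Alfeld split. -/
structure AlfeldSplit where
  /-- the tetrahedron, given by its affinely independent vertices -/
  simplex : Affine.Simplex ℝ Vec 3
  /-- the split point -/
  z : Vec
  z_mem : z ∈ interior (convexHull ℝ (Set.range simplex.points))

namespace AlfeldSplit

variable (A : AlfeldSplit)

/-- The closed tetrahedron `T`. -/
def T : Set Vec := convexHull ℝ (Set.range A.simplex.points)

/-- The cell `T_i` of the Alfeld split: the vertex `x_i` is replaced by `z`. -/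
def cell (i : Fin 4) : Set Vec := convexHull ℝ (Set.range (Function.update A.simplex.points i A.z))

/-- The (closed) facet `F_i` of `T` opposite to the vertex `x_i`. -/
def facet (i : Fin 4) : Set Vec := convexHull ℝ (A.simplex.points '' {i}ᶜ)

/-- The outward unit normal of `T` on `F_i`: the normalized vector from the vertex `x_i` to its
orthogonal projection onto the plane of `F_i`. -/
def normal (i : Fin 4) : Vec :=
  ‖A.simplex.altitudeFoot i - A.simplex.points i‖⁻¹ •
    (A.simplex.altitudeFoot i - A.simplex.points i)

/-- The surface (two-dimensional Hausdorff, normalized as area) measure on the facet `F_i`. -/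
def surface (i : Fin 4) : Measure (A.facet i) :=
  (Measure.euclideanHausdorffMeasure 2 : Measure Vec).comap Subtype.val

/-- Lebesgue measure on `T`. -/
def vol : Measure Vec := volume.restrict A.T

/-- The space `L²(T, 𝕄)`: matrix fields whose components are in `L²(T)`. -/
abbrev L2Mat : Type := Matrix (Fin 3) (Fin 3) (Lp ℝ 2 A.vol)

/-- The space `L²(T, ℝ³)`, with its inner product. -/
abbrev L2Vec : Type := Lp Vec 2 A.vol

/-! ### Geometry of the cells -/

theorem cell_subset (i : Fin 4) : A.cell i ⊆ A.T := by
  refine convexHull_min ?_ (convex_convexHull ℝ _)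
  rintro _ ⟨j, rfl⟩
  rcases eq_or_ne j i with rfl | h
  · rw [Function.update_self]
    exact interior_subset A.z_mem
  · rw [Function.update_of_ne h]
    exact subset_convexHull ℝ _ ⟨j, rfl⟩

theorem affineSpan_eq_top (p : Fin 4 → Vec) (hp : AffineIndependent ℝ p) :
    affineSpan ℝ (Set.range p) = ⊤ := by
  rw [hp.affineSpan_eq_top_iff_card_eq_finrank_add_one]
  simp

theorem interior_cell_nonempty (i : Fin 4) : (interior (A.cell i)).Nonempty := by
  rw [cell, interior_convexHull_nonempty_iff_affineSpan_eq_top]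
  apply affineSpan_eq_top
  apply A.simplex.independent.affineIndependent_update_of_notMem_affineSpan
  let b : AffineBasis (Fin 4) ℝ Vec :=
    ⟨A.simplex.points, A.simplex.independent, affineSpan_eq_top _ A.simplex.independent⟩
  have hz : A.z ∈ interior (convexHull ℝ (Set.range b)) := A.z_mem
  rw [b.interior_convexHull] at hz
  intro hmem
  have key : affineSpan ℝ (A.simplex.points '' {x | x ≠ i}) ≤
      (affineSpan ℝ {(0 : ℝ)}).comap (b.coord i) := by
    rw [affineSpan_le]
    rintro _ ⟨j, hj, rfl⟩
    have : b.coord i (A.simplex.points j) = 0 := b.coord_apply_ne (Ne.symm hj)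
    simp [this]
  have h0 := key hmem
  have h1 := hz i
  rw [AffineSubspace.mem_comap, AffineSubspace.mem_affineSpan_singleton] at h0
  exact h1.ne' h0

theorem isClosed_cell (i : Fin 4) : IsClosed (A.cell i) :=
  ((Set.finite_range _).isCompact_convexHull ℝ).isClosed

theorem isCompact_T : IsCompact A.T :=
  (Set.finite_range _).isCompact_convexHull ℝ

instance : IsFiniteMeasure A.vol :=
  ⟨by simpa [vol] using A.isCompact_T.measure_lt_top⟩

/-- A property that holds almost everywhere in `T` holds almost everywhere in each cell. -/
theorem ae_cell {P : Vec → Prop} (h : ∀ᵐ x ∂A.vol, P x) (i : Fin 4) :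
    ∀ᵐ x ∂(volume.restrict (A.cell i)), P x :=
  ae_restrict_of_ae_restrict_of_subset (A.cell_subset i) h

/-- Affine functions that agree almost everywhere on a cell are equal. -/
theorem affine_unique {E : Type*} [NormedAddCommGroup E] [NormedSpace ℝ E] (i : Fin 4)
    {p q : Vec →ᵃ[ℝ] E} (h : p =ᵐ[volume.restrict (A.cell i)] q) : p = q := by
  have h1 : p =ᵐ[volume.restrict (interior (A.cell i))] q :=
    ae_restrict_of_ae_restrict_of_subset interior_subset h
  have h2 : Set.EqOn p q (interior (A.cell i)) :=
    Measure.eqOn_open_of_ae_eq h1 isOpen_interior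
      (p.continuous_of_finiteDimensional).continuousOn
      (q.continuous_of_finiteDimensional).continuousOn
  have h3 := isOpen_interior.affineSpan_eq_top (A.interior_cell_nonempty i)
  ext x
  have hx : x ∈ affineSpan ℝ (interior (A.cell i)) := by rw [h3]; trivial
  exact congrFun (congrArg DFunLike.coe (AffineMap.ext_on h3 h2)) x

/-! ### The stress space `Σ_h(T)` -/

/-- `p` is the polynomial of degree at most one that represents `ω` on the cell `T_i`. -/
def IsPiece (ω : A.L2Mat) (i : Fin 4) (p : Vec →ᵃ[ℝ] Mat) : Prop :=
  ∀ k l, ω k l =ᵐ[volume.restrict (A.cell i)] fun x => p x k l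

/-- `d ∈ L²(T, ℝ³)` is the row-wise divergence of `ω ∈ L²(T, 𝕄)` in the sense of distributions
on the interior of `T`. -/
def IsDiv (ω : A.L2Mat) (d : A.L2Vec) : Prop :=
  ∀ φ : Vec → ℝ, ContDiff ℝ (⊤ : ℕ∞) φ → HasCompactSupport φ → tsupport φ ⊆ interior A.T →
    ∀ i : Fin 3,
      ∫ x, ∑ j : Fin 3, ω i j x * fderiv ℝ φ x (EuclideanSpace.single j 1) ∂A.vol =
        - ∫ x, d x i * φ x ∂A.vol

theorem IsPiece.add {ω ω' : A.L2Mat} {i : Fin 4} {p p' : Vec →ᵃ[ℝ] Mat}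
    (h : A.IsPiece ω i p) (h' : A.IsPiece ω' i p') : A.IsPiece (ω + ω') i (p + p') := by
  intro k l
  filter_upwards [h k l, h' k l, A.ae_cell (Lp.coeFn_add (ω k l) (ω' k l)) i] with x h1 h2 h3
  rw [Matrix.add_apply, h3, Pi.add_apply, h1, h2]
  rfl

theorem IsPiece.smul (c : ℝ) {ω : A.L2Mat} {i : Fin 4} {p : Vec →ᵃ[ℝ] Mat}
    (h : A.IsPiece ω i p) : A.IsPiece (c • ω) i (c • p) := by
  intro k l
  filter_upwards [h k l, A.ae_cell (Lp.coeFn_smul c (ω k l)) i] with x h1 h3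
  rw [Matrix.smul_apply, h3, Pi.smul_apply, h1]
  rfl

theorem IsPiece.zero (i : Fin 4) : A.IsPiece 0 i 0 := by
  intro k l
  filter_upwards [A.ae_cell (Lp.coeFn_zero ℝ 2 A.vol) i] with x h1
  rw [Matrix.zero_apply, h1]
  rfl

theorem integrable_entry (ω : A.L2Mat) (i j : Fin 3) : Integrable (fun x => ω i j x) A.vol :=
  (Lp.memLp (ω i j)).integrable (by norm_num)

theorem integrable_coord (d : A.L2Vec) (i : Fin 3) : Integrable (fun x => d x i) A.vol := by
  have h : Integrable (fun x => d x) A.vol := (Lp.memLp d).integrable (by norm_num)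
  refine h.mono ?_ (Filter.Eventually.of_forall fun x => PiLp.norm_apply_le _ i)
  exact (EuclideanSpace.proj (𝕜 := ℝ) i).continuous.comp_aestronglyMeasurable
    h.aestronglyMeasurable

theorem integrable_mul_test {f g : Vec → ℝ} (hf : Integrable f A.vol) (hg : Continuous g)
    (hs : HasCompactSupport g) : Integrable (fun x => f x * g x) A.vol := by
  obtain ⟨C, hC⟩ := hs.exists_bound_of_continuous hg
  exact hf.mul_bdd (c := C) hg.aestronglyMeasurable (Filter.Eventually.of_forall hC)

theorem integrable_div_left (ω : A.L2Mat) {φ : Vec → ℝ} (hφ : ContDiff ℝ (⊤ : ℕ∞) φ)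
    (hs : HasCompactSupport φ) (i : Fin 3) :
    Integrable (fun x => ∑ j : Fin 3, ω i j x * fderiv ℝ φ x (EuclideanSpace.single j 1))
      A.vol := by
  refine integrable_finsetSum _ fun j _ => A.integrable_mul_test (A.integrable_entry ω i j) ?_ ?_
  · exact (hφ.continuous_fderiv (by simp)).clm_apply continuous_const
  · exact hs.fderiv_apply ℝ _

theorem IsDiv.add {ω ω' : A.L2Mat} {d d' : A.L2Vec} (h : A.IsDiv ω d) (h' : A.IsDiv ω' d') :
    A.IsDiv (ω + ω') (d + d') := by
  intro φ hφ hs ht i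
  have e1 := h φ hφ hs ht i
  have e2 := h' φ hφ hs ht i
  have a1 : ∫ x, ∑ j : Fin 3, (ω + ω') i j x * fderiv ℝ φ x (EuclideanSpace.single j 1) ∂A.vol =
      ∫ x, (∑ j : Fin 3, ω i j x * fderiv ℝ φ x (EuclideanSpace.single j 1) +
        ∑ j : Fin 3, ω' i j x * fderiv ℝ φ x (EuclideanSpace.single j 1)) ∂A.vol := by
    refine integral_congr_ae ?_
    have hall : ∀ᵐ x ∂A.vol, ∀ j, (ω i j + ω' i j) x = ω i j x + ω' i j x :=
      ae_all_iff.2 fun j => Lp.coeFn_add (ω i j) (ω' i j)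
    filter_upwards [hall] with x hx
    rw [← Finset.sum_add_distrib]
    simp only [Matrix.add_apply, hx, add_mul]
  have a2 : ∫ x, (d + d') x i * φ x ∂A.vol = ∫ x, (d x i * φ x + d' x i * φ x) ∂A.vol := by
    refine integral_congr_ae ?_
    filter_upwards [Lp.coeFn_add d d'] with x hx
    rw [hx]
    simp only [Pi.add_apply, PiLp.add_apply, add_mul]
  rw [a1, a2, integral_add (A.integrable_div_left ω hφ hs i) (A.integrable_div_left ω' hφ hs i),
    integral_add (A.integrable_mul_test (A.integrable_coord d i) hφ.continuous hs)
      (A.integrable_mul_test (A.integrable_coord d' i) hφ.continuous hs), e1, e2, neg_add]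

theorem IsDiv.smul (c : ℝ) {ω : A.L2Mat} {d : A.L2Vec} (h : A.IsDiv ω d) :
    A.IsDiv (c • ω) (c • d) := by
  intro φ hφ hs ht i
  have e1 := h φ hφ hs ht i
  have a1 : ∫ x, ∑ j : Fin 3, (c • ω) i j x * fderiv ℝ φ x (EuclideanSpace.single j 1) ∂A.vol =
      ∫ x, c * ∑ j : Fin 3, ω i j x * fderiv ℝ φ x (EuclideanSpace.single j 1) ∂A.vol := by
    refine integral_congr_ae ?_
    have hall : ∀ᵐ x ∂A.vol, ∀ j, (c • ω i j) x = c * ω i j x :=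
      ae_all_iff.2 fun j => Lp.coeFn_smul c (ω i j)
    filter_upwards [hall] with x hx
    rw [Finset.mul_sum]
    simp only [Matrix.smul_apply, hx, mul_assoc]
  have a2 : ∫ x, (c • d) x i * φ x ∂A.vol = ∫ x, c * (d x i * φ x) ∂A.vol := by
    refine integral_congr_ae ?_
    filter_upwards [Lp.coeFn_smul c d] with x hx
    rw [hx]
    simp only [Pi.smul_apply, PiLp.smul_apply, smul_eq_mul, mul_assoc]
  rw [a1, a2, integral_const_mul, integral_const_mul, e1, mul_neg]

theorem IsDiv.zero : A.IsDiv 0 0 := by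
  intro φ hφ hs ht i
  have a1 : ∫ x, ∑ j : Fin 3, (0 : A.L2Mat) i j x * fderiv ℝ φ x (EuclideanSpace.single j 1)
      ∂A.vol = 0 := by
    refine integral_eq_zero_of_ae ?_
    filter_upwards [Lp.coeFn_zero ℝ 2 A.vol] with x hx
    refine Finset.sum_eq_zero fun j _ => ?_
    rw [Matrix.zero_apply, hx, Pi.zero_apply, zero_mul]
  have a2 : ∫ x, (0 : A.L2Vec) x i * φ x ∂A.vol = 0 := by
    refine integral_eq_zero_of_ae ?_
    filter_upwards [Lp.coeFn_zero Vec 2 A.vol] with x hx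
    rw [hx]
    simp
  rw [a1, a2, neg_zero]

/-- The stress space `Σ_h(T)`: symmetric matrix fields in `H(div, T, 𝕊)` that are polynomials of
degree at most one on each cell of the Alfeld split. -/
def SigmaH : Submodule ℝ A.L2Mat where
  carrier := {ω | ω.IsSymm ∧ (∃ d : A.L2Vec, A.IsDiv ω d) ∧
    ∀ i, ∃ p : Vec →ᵃ[ℝ] Mat, A.IsPiece ω i p}
  zero_mem' := ⟨Matrix.isSymm_zero, ⟨0, IsDiv.zero A⟩, fun i => ⟨0, IsPiece.zero A i⟩⟩
  add_mem' := by
    rintro ω ω' ⟨hs, ⟨d, hd⟩, hp⟩ ⟨hs', ⟨d', hd'⟩, hp'⟩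
    refine ⟨hs.add hs', ⟨d + d', hd.add A hd'⟩, fun i => ?_⟩
    obtain ⟨p, hp⟩ := hp i
    obtain ⟨p', hp'⟩ := hp' i
    exact ⟨p + p', hp.add A hp'⟩
  smul_mem' := by
    rintro c ω ⟨hs, ⟨d, hd⟩, hp⟩
    refine ⟨hs.smul c, ⟨c • d, hd.smul A c⟩, fun i => ?_⟩
    obtain ⟨p, hp⟩ := hp i
    exact ⟨c • p, hp.smul A c⟩

open Classical in
/-- The affine matrix field that represents `ω` on the cell `T_i` (zero if there is none). -/
def piece (ω : A.L2Mat) (i : Fin 4) : Vec →ᵃ[ℝ] Mat :=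
  if h : ∃ p : Vec →ᵃ[ℝ] Mat, A.IsPiece ω i p then h.choose else 0

theorem piece_spec {ω : A.L2Mat} (hω : ω ∈ A.SigmaH) (i : Fin 4) : A.IsPiece ω i (A.piece ω i) := by
  have h := hω.2.2 i
  rw [piece, dif_pos h]
  exact h.choose_spec

theorem piece_eq {ω : A.L2Mat} {i : Fin 4} {p : Vec →ᵃ[ℝ] Mat} (hp : A.IsPiece ω i p) :
    A.piece ω i = p := by
  have h : ∃ p : Vec →ᵃ[ℝ] Mat, A.IsPiece ω i p := ⟨p, hp⟩
  rw [piece, dif_pos h]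
  ext x k l
  let e : Mat →ᵃ[ℝ] ℝ := (Matrix.entryLinearMap ℝ ℝ k l).toAffineMap
  have h1 : (e.comp h.choose : Vec → ℝ) =ᵐ[volume.restrict (A.cell i)] (e.comp p : Vec → ℝ) :=
    (h.choose_spec k l).symm.trans (hp k l)
  exact congrFun (congrArg DFunLike.coe (A.affine_unique i h1)) x

/-! ### Traces on the facets -/

/-- The normal trace `ω n` on the facet `F_i`, taken from the cell `T_i` that contains `F_i`. -/
def normalTrace (ω : A.L2Mat) (i : Fin 4) (x : A.facet i) : Vec :=
  (A.piece ω i x).toEuclideanLin (A.normal i)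

/-- `ω_nn = ω n · n` on the facet `F_i`. -/
def traceNN (ω : A.L2Mat) (i : Fin 4) (x : A.facet i) : ℝ :=
  inner ℝ (A.normalTrace ω i x) (A.normal i)

/-- `ω_nt = n × (ω n × n)` on the facet `F_i`. -/
def traceNT (ω : A.L2Mat) (i : Fin 4) (x : A.facet i) : Vec :=
  cross (A.normal i) (cross (A.normalTrace ω i x) (A.normal i))

/-! ### Polynomials and rigid motions -/

/-- `P₁(F_i)`: real polynomials of degree at most one, restricted to `F_i`. -/
def P1 (i : Fin 4) : Submodule ℝ (A.facet i → ℝ) where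
  carrier := {κ | ∃ p : Vec →ᵃ[ℝ] ℝ, ∀ x : A.facet i, κ x = p x}
  zero_mem' := ⟨0, fun _ => rfl⟩
  add_mem' := by
    rintro κ κ' ⟨p, hp⟩ ⟨p', hp'⟩
    exact ⟨p + p', fun x => by simp [hp, hp']⟩
  smul_mem' := by
    rintro c κ ⟨p, hp⟩
    exact ⟨c • p, fun x => by simp [hp]⟩

/-- `R(F_i)`: the (tangential) rigid motions of the facet `F_i`, that is, the fields
`x ↦ a + β n × x` with `a · n = 0`. -/
def RF (i : Fin 4) : Submodule ℝ (A.facet i → Vec) where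
  carrier := {κ | ∃ (a : Vec) (β : ℝ), inner ℝ a (A.normal i) = 0 ∧
    ∀ x : A.facet i, κ x = a + β • cross (A.normal i) x}
  zero_mem' := ⟨0, 0, by simp, fun x => by simp⟩
  add_mem' := by
    rintro κ κ' ⟨a, β, h, hκ⟩ ⟨a', β', h', hκ'⟩
    refine ⟨a + a', β + β', by rw [inner_add_left, h, h', add_zero], fun x => ?_⟩
    rw [Pi.add_apply, hκ, hκ', add_smul]
    abel
  smul_mem' := by
    rintro c κ ⟨a, β, h, hκ⟩
    refine ⟨c • a, c * β, by rw [real_inner_smul_left, h, mul_zero], fun x => ?_⟩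
    rw [Pi.smul_apply, hκ, smul_add, smul_smul]

theorem cross_add_left (a b x : Vec) : cross (a + b) x = cross a x + cross b x := by
  simp [cross]

theorem cross_smul_left (c : ℝ) (a x : Vec) : cross (c • a) x = c • cross a x := by
  simp [cross]

theorem cross_zero_left (x : Vec) : cross 0 x = 0 := by
  simp [cross]

theorem cross_add_right (a x y : Vec) : cross a (x + y) = cross a x + cross a y := by
  simp [cross]

theorem cross_smul_right (c : ℝ) (a x : Vec) : cross a (c • x) = c • cross a x := by
  simp [cross]

theorem cross_zero_right (a : Vec) : cross a 0 = 0 := by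
  simp [cross]

/-- `R(T)`: the (classes of the) rigid displacements `x ↦ a + b × x` on `T`. -/
def RT : Submodule ℝ A.L2Vec where
  carrier := {v | ∃ a b : Vec, v =ᵐ[A.vol] fun x => a + cross b x}
  zero_mem' := by
    refine ⟨0, 0, ?_⟩
    filter_upwards [Lp.coeFn_zero Vec 2 A.vol] with x hx
    rw [hx, cross_zero_left, add_zero]
    rfl
  add_mem' := by
    rintro v v' ⟨a, b, h⟩ ⟨a', b', h'⟩
    refine ⟨a + a', b + b', ?_⟩
    filter_upwards [h, h', Lp.coeFn_add v v'] with x h1 h2 h3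
    rw [h3, Pi.add_apply, h1, h2, cross_add_left]
    abel
  smul_mem' := by
    rintro c v ⟨a, b, h⟩
    refine ⟨c • a, c • b, ?_⟩
    filter_upwards [h, Lp.coeFn_smul c v] with x h1 h3
    rw [h3, Pi.smul_apply, h1, cross_smul_left, smul_add]

/-- `W_h(T)`: the vector fields that are constant on each cell of the Alfeld split. -/
def WH : Submodule ℝ A.L2Vec where
  carrier := {w | ∀ i, ∃ c : Vec, w =ᵐ[volume.restrict (A.cell i)] fun _ => c}
  zero_mem' := by
    refine fun i => ⟨0, ?_⟩
    filter_upwards [A.ae_cell (Lp.coeFn_zero Vec 2 A.vol) i] with x hx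
    rw [hx]
    rfl
  add_mem' := by
    intro v v' h h' i
    obtain ⟨c, h⟩ := h i
    obtain ⟨c', h'⟩ := h' i
    refine ⟨c + c', ?_⟩
    filter_upwards [h, h', A.ae_cell (Lp.coeFn_add v v') i] with x h1 h2 h3
    rw [h3, Pi.add_apply, h1, h2]
  smul_mem' := by
    intro k v h i
    obtain ⟨c, h⟩ := h i
    refine ⟨k • c, ?_⟩
    filter_upwards [h, A.ae_cell (Lp.coeFn_smul k v) i] with x h1 h3
    rw [h3, Pi.smul_apply, h1]

/-- `w = P_T v`, where `P_T` is the `L²(T)`-orthogonal projection onto `W_h(T)`. -/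
def IsProj (v w : A.L2Vec) : Prop :=
  w ∈ A.WH ∧ ∀ m ∈ A.WH, inner ℝ w m = inner ℝ v m

/-- `P_T R(T)`, the image of `R(T)` under the projection `P_T`. -/
def PTR : Submodule ℝ A.L2Vec where
  carrier := {w | ∃ v ∈ A.RT, A.IsProj v w}
  zero_mem' := ⟨0, A.RT.zero_mem, A.WH.zero_mem, fun _ _ => rfl⟩
  add_mem' := by
    rintro w w' ⟨v, hv, hw, h⟩ ⟨v', hv', hw', h'⟩
    refine ⟨v + v', A.RT.add_mem hv hv', A.WH.add_mem hw hw', fun m hm => ?_⟩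
    rw [inner_add_left, inner_add_left, h m hm, h' m hm]
  smul_mem' := by
    rintro c w ⟨v, hv, hw, h⟩
    refine ⟨c • v, A.RT.smul_mem c hv, A.WH.smul_mem c hw, fun m hm => ?_⟩
    rw [real_inner_smul_left, real_inner_smul_left, h m hm]

/-! ### Linearity of the traces on `Σ_h(T)` -/

theorem normalTrace_zero (i : Fin 4) : A.normalTrace 0 i = 0 := by
  ext1 x
  rw [normalTrace, A.piece_eq (IsPiece.zero A i)]
  simp

theorem normalTrace_add {ω ω' : A.L2Mat} (h : ω ∈ A.SigmaH) (h' : ω' ∈ A.SigmaH) (i : Fin 4) :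
    A.normalTrace (ω + ω') i = A.normalTrace ω i + A.normalTrace ω' i := by
  ext1 x
  simp only [normalTrace, Pi.add_apply,
    A.piece_eq ((A.piece_spec h i).add A (A.piece_spec h' i))]
  simp

theorem normalTrace_smul (c : ℝ) {ω : A.L2Mat} (h : ω ∈ A.SigmaH) (i : Fin 4) :
    A.normalTrace (c • ω) i = c • A.normalTrace ω i := by
  ext1 x
  simp only [normalTrace, Pi.smul_apply, A.piece_eq ((A.piece_spec h i).smul A c)]
  simp

theorem traceNT_zero (i : Fin 4) : A.traceNT 0 i = 0 := by
  ext1 x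
  simp [traceNT, normalTrace_zero, cross_zero_left, cross_zero_right]

theorem traceNT_add {ω ω' : A.L2Mat} (h : ω ∈ A.SigmaH) (h' : ω' ∈ A.SigmaH) (i : Fin 4) :
    A.traceNT (ω + ω') i = A.traceNT ω i + A.traceNT ω' i := by
  ext1 x
  simp only [traceNT, A.normalTrace_add h h', Pi.add_apply, cross_add_left, cross_add_right]

theorem traceNT_smul (c : ℝ) {ω : A.L2Mat} (h : ω ∈ A.SigmaH) (i : Fin 4) :
    A.traceNT (c • ω) i = c • A.traceNT ω i := by
  ext1 x
  simp only [traceNT, A.normalTrace_smul c h, Pi.smul_apply, cross_smul_left, cross_smul_right]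

/-! ### The reduced stress space and its degrees of freedom -/

/-- The reduced stress space `Σ_h^R(T)`: the `ω ∈ Σ_h(T)` with `div ω ∈ P_T R(T)` and
`ω_nt ∈ R(F)` for every facet `F` of `T`. -/
def SigmaR : Submodule ℝ A.L2Mat where
  carrier := {ω | ω ∈ A.SigmaH ∧ (∃ d ∈ A.PTR, A.IsDiv ω d) ∧ ∀ i, A.traceNT ω i ∈ A.RF i}
  zero_mem' := by
    refine ⟨A.SigmaH.zero_mem, ⟨0, A.PTR.zero_mem, IsDiv.zero A⟩, fun i => ?_⟩
    rw [traceNT_zero]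
    exact (A.RF i).zero_mem
  add_mem' := by
    rintro ω ω' ⟨hs, ⟨d, hd, h⟩, ht⟩ ⟨hs', ⟨d', hd', h'⟩, ht'⟩
    refine ⟨A.SigmaH.add_mem hs hs', ⟨d + d', A.PTR.add_mem hd hd', h.add A h'⟩, fun i => ?_⟩
    rw [A.traceNT_add hs hs']
    exact (A.RF i).add_mem (ht i) (ht' i)
  smul_mem' := by
    rintro c ω ⟨hs, ⟨d, hd, h⟩, ht⟩
    refine ⟨A.SigmaH.smul_mem c hs, ⟨c • d, A.PTR.smul_mem c hd, h.smul A c⟩, fun i => ?_⟩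
    rw [A.traceNT_smul c hs]
    exact (A.RF i).smul_mem c (ht i)

/-- The degree of freedom `∫_F ω_nn κ ds` on the facet `F = F_i`. -/
def dofNN (ω : A.L2Mat) (i : Fin 4) (κ : A.facet i → ℝ) : ℝ :=
  ∫ x, A.traceNN ω i x * κ x ∂A.surface i

/-- The degree of freedom `∫_F ω_nt · κ ds` on the facet `F = F_i`. -/
def dofNT (ω : A.L2Mat) (i : Fin 4) (κ : A.facet i → Vec) : ℝ :=
  ∫ x, inner ℝ (A.traceNT ω i x) (κ x) ∂A.surface i

end AlfeldSplit

end JKM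

end

noncomputable section

namespace JKM

namespace AlfeldSplit
variable (A : AlfeldSplit)
open Matrix

/-- The vertices of `T` as an affine basis. -/
def basis : AffineBasis (Fin 4) ℝ Vec :=
  ⟨A.simplex.points, A.simplex.independent, affineSpan_eq_top _ A.simplex.independent⟩

@[simp] theorem basis_apply (i : Fin 4) : A.basis i = A.simplex.points i := rfl

/-- The barycentric coordinates of the split point. -/
def weight (i : Fin 4) : ℝ := A.basis.coord i A.z

/-- The vertices relative to the split point. -/
def vtx (i : Fin 4) : Fin 3 → ℝ := (A.simplex.points i - A.z).ofLp

/-- The gradient, on the cell `T_i`, of the piecewise linear function that is `1` at the split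
point and vanishes on the boundary of `T`. -/
def grad (i : Fin 4) : Fin 3 → ℝ :=
  fun c => (A.basis.coord i).linear (EuclideanSpace.single c 1) / A.weight i

/-- The linear form `x ↦ grad i · (x - z)`. -/
def gam (i : Fin 4) (x : Vec) : ℝ := A.grad i ⬝ᵥ (x - A.z).ofLp

theorem T_eq_convexHull : A.T = convexHull ℝ (Set.range A.basis) := rfl

theorem weight_pos (i : Fin 4) : 0 < A.weight i := by
  have hz : A.z ∈ interior (convexHull ℝ (Set.range A.basis)) := A.z_mem
  rw [A.basis.interior_convexHull] at hz
  exact hz i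

theorem sum_weight : ∑ i, A.weight i = 1 := A.basis.sum_coord_apply_eq_one A.z

theorem linear_coord (i : Fin 4) (v : Vec) :
    (A.basis.coord i).linear v = A.weight i * (A.grad i ⬝ᵥ v.ofLp) := by
  have h : v = ∑ c, v c • EuclideanSpace.single c (1 : ℝ) := by
    ext j
    simp [Pi.single_apply]
  have hw := (A.weight_pos i).ne'
  conv_lhs => rw [h]
  rw [map_sum, dotProduct, Finset.mul_sum]
  refine Finset.sum_congr rfl fun c _ => ?_
  rw [map_smul, grad, smul_eq_mul]
  field_simp

theorem coord_eq (i : Fin 4) (x : Vec) :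
    A.basis.coord i x = A.weight i * (1 + A.gam i x) := by
  have h := (A.basis.coord i).map_vadd A.z (x - A.z)
  rw [vadd_eq_add, sub_add_cancel, linear_coord, vadd_eq_add] at h
  rw [h, gam, weight]
  ring

theorem grad_dot_vtx (i j : Fin 4) :
    A.grad i ⬝ᵥ A.vtx j = (if i = j then (A.weight i)⁻¹ else 0) - 1 := by
  have h := A.coord_eq i (A.simplex.points j)
  have h2 := A.basis.coord_apply i j
  rw [basis_apply, h] at h2
  have hw := (A.weight_pos i).ne'
  change A.gam i (A.simplex.points j) = _
  split_ifs at h2 ⊢ with hij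
  · field_simp
    linarith
  · have := (mul_eq_zero.1 h2).resolve_left hw
    linarith

theorem sum_weight_smul_vtx : ∑ i, A.weight i • A.vtx i = 0 := by
  have h := A.basis.linear_combination_coord_eq_self A.z
  have h2 : ∑ i, A.weight i • (A.simplex.points i - A.z) = 0 := by
    simp only [smul_sub, Finset.sum_sub_distrib, ← Finset.sum_smul, sum_weight, one_smul]
    rw [sub_eq_zero]
    exact h
  have := congrArg WithLp.ofLp h2
  simpa [vtx] using this

/-- The point `z + v` has barycentric coordinates `w_i (1 + g_i · v)`; subtracting the expansion of
`z` leaves the resolution of the identity `∑ w_i (x_i - z) ⊗ g_i = 1`. Its transpose is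
`sum_smul_grad`. -/
theorem sum_smul_vtx (v : Fin 3 → ℝ) : ∑ i, (A.weight i * (A.grad i ⬝ᵥ v)) • A.vtx i = v := by
  have h := A.basis.linear_combination_coord_eq_self (WithLp.toLp 2 v + A.z)
  have h0 := A.basis.linear_combination_coord_eq_self A.z
  have hs := A.basis.sum_coord_apply_eq_one (WithLp.toLp 2 v + A.z)
  have key : ∀ i, A.basis.coord i (WithLp.toLp 2 v + A.z) =
      A.weight i * (1 + A.grad i ⬝ᵥ v) := fun i => by
    rw [coord_eq, gam, add_sub_cancel_right]
  simp only [key] at h hs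
  have hs2 : ∑ i, A.weight i * (A.grad i ⬝ᵥ v) = 0 := by
    have : ∑ i, A.weight i * (1 + A.grad i ⬝ᵥ v) =
      ∑ i, A.weight i + ∑ i, A.weight i * (A.grad i ⬝ᵥ v) := by
      rw [← Finset.sum_add_distrib]
      exact Finset.sum_congr rfl fun i _ => by ring
    rw [hs, sum_weight] at this
    linarith
  have h3 : ∑ i, (A.weight i * (A.grad i ⬝ᵥ v)) • (A.simplex.points i - A.z) =
      WithLp.toLp 2 v := by
    simp only [smul_sub, Finset.sum_sub_distrib, ← Finset.sum_smul, hs2, zero_smul, sub_zero]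
    have h4 : ∑ i, (A.weight i * (1 + A.grad i ⬝ᵥ v)) • A.basis i =
      ∑ i, A.weight i • A.basis i + ∑ i, (A.weight i * (A.grad i ⬝ᵥ v)) • A.basis i := by
      rw [← Finset.sum_add_distrib]
      exact Finset.sum_congr rfl fun i _ => by rw [← add_smul]; ring_nf
    have h0' : ∑ i, A.weight i • A.basis i = A.z := h0
    rw [h, h0', add_comm] at h4
    exact (add_left_cancel h4).symm
  have := congrArg WithLp.ofLp h3
  simpa [vtx] using this

theorem sum_smul_grad (v : Fin 3 → ℝ) : ∑ i, (A.weight i * (A.vtx i ⬝ᵥ v)) • A.grad i = v := by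
  refine dotProduct_eq _ _ fun u => ?_
  have h := congrArg (v ⬝ᵥ ·) (A.sum_smul_vtx u)
  simp only [dotProduct_sum, dotProduct_smul, sum_dotProduct, smul_dotProduct] at h ⊢
  rw [← h]
  refine Finset.sum_congr rfl fun i _ => ?_
  rw [dotProduct_comm v, smul_eq_mul, smul_eq_mul]
  ring

theorem sum_weight_smul_grad : ∑ i, A.weight i • A.grad i = 0 := by
  refine dotProduct_eq _ _ fun u => ?_
  have h : ∑ i, A.weight i * (A.grad i ⬝ᵥ u) = 0 := by
    have hs := A.basis.sum_coord_apply_eq_one (WithLp.toLp 2 u + A.z)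
    simp only [coord_eq, gam, add_sub_cancel_right, mul_add, mul_one, Finset.sum_add_distrib,
      sum_weight] at hs
    linarith
  simpa [sum_dotProduct, smul_dotProduct] using h

theorem sum_weight_mul_gam (x : Vec) : ∑ i, A.weight i * A.gam i x = 0 := by
  have := congrArg (· ⬝ᵥ (x - A.z).ofLp) A.sum_weight_smul_grad
  simpa [gam, sum_dotProduct, smul_dotProduct, -WithLp.ofLp_sub, -dotProduct_sub] using this

/-! ### The cells in terms of `gam` -/

theorem affineIndependent_cell (i : Fin 4) :
    AffineIndependent ℝ (Function.update A.simplex.points i A.z) := by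
  apply A.simplex.independent.affineIndependent_update_of_notMem_affineSpan
  intro hmem
  have key : affineSpan ℝ (A.simplex.points '' {x | x ≠ i}) ≤
      (affineSpan ℝ {(0 : ℝ)}).comap (A.basis.coord i) := by
    rw [affineSpan_le]
    rintro _ ⟨j, hj, rfl⟩
    have : A.basis.coord i (A.simplex.points j) = 0 := A.basis.coord_apply_ne (Ne.symm hj)
    simp [this]
  have h0 := key hmem
  rw [AffineSubspace.mem_comap, AffineSubspace.mem_affineSpan_singleton] at h0
  exact (A.weight_pos i).ne' h0

/-- The vertices of the cell `T_i` as an affine basis. -/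
def cellBasis (i : Fin 4) : AffineBasis (Fin 4) ℝ Vec :=
  ⟨Function.update A.simplex.points i A.z, A.affineIndependent_cell i,
    affineSpan_eq_top _ (A.affineIndependent_cell i)⟩

theorem cellBasis_apply (i j : Fin 4) :
    A.cellBasis i j = Function.update A.simplex.points i A.z j := rfl

/-- The barycentric coordinates in the cell `T_i`. -/
def cellCoord (i j : Fin 4) (x : Vec) : ℝ :=
  if j = i then 1 + A.gam i x else A.weight j * (A.gam j x - A.gam i x)

theorem sum_cellCoord (i : Fin 4) (x : Vec) : ∑ j, A.cellCoord i j x = 1 := by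
  have h : ∀ j, A.cellCoord i j x = A.weight j * A.gam j x - A.weight j * A.gam i x +
      if j = i then 1 + A.gam i x else 0 := by
    intro j
    rw [cellCoord]
    split_ifs with h
    · subst h; ring
    · ring
  simp only [h, Finset.sum_add_distrib, Finset.sum_sub_distrib, ← Finset.sum_mul, sum_weight,
    sum_weight_mul_gam]
  simp

theorem sum_cellCoord_smul (i : Fin 4) (x : Vec) :
    ∑ j, A.cellCoord i j x • Function.update A.simplex.points i A.z j = x := by
  have h : ∀ j, A.cellCoord i j x • (Function.update A.simplex.points i A.z j - A.z) =
      (A.weight j * A.gam j x) • WithLp.toLp 2 (A.vtx j) -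
        A.gam i x • A.weight j • WithLp.toLp 2 (A.vtx j) := by
    intro j
    rw [cellCoord]
    split_ifs with h
    · subst h
      rw [Function.update_self, sub_self, smul_zero, smul_smul, ← sub_smul]
      rw [mul_comm, sub_self, zero_smul]
    · rw [Function.update_of_ne h, smul_smul, ← sub_smul, vtx]
      congr 1
      ring
  have h2 : ∑ j, A.cellCoord i j x • (Function.update A.simplex.points i A.z j - A.z) =
      x - A.z := by
    rw [Finset.sum_congr rfl fun j _ => h j, Finset.sum_sub_distrib, ← Finset.smul_sum]
    have e1 := congrArg (WithLp.toLp 2) (A.sum_smul_vtx (x - A.z).ofLp)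
    have e2 := congrArg (WithLp.toLp 2) A.sum_weight_smul_vtx
    simp only [WithLp.toLp_sum, WithLp.toLp_smul, WithLp.toLp_zero] at e1 e2
    rw [e2, smul_zero, sub_zero]
    exact e1
  simp only [smul_sub, Finset.sum_sub_distrib, ← Finset.sum_smul, sum_cellCoord, one_smul] at h2
  exact sub_left_injective h2

theorem cellBasis_coord (i j : Fin 4) (x : Vec) :
    (A.cellBasis i).coord j x = A.cellCoord i j x := by
  have h := (A.cellBasis i).coord_apply_combination_of_mem (Finset.mem_univ j)
    (A.sum_cellCoord i x)
  rw [← h]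
  congr 1
  rw [Finset.affineCombination_eq_linear_combination _ _ _ (A.sum_cellCoord i x)]
  exact (A.sum_cellCoord_smul i x).symm

/-- The hat function of the split point is `1 + min_j gam j`, and `T_i` is the part of `T` on which
the minimum is attained at `i`. Hence the face between `T_i` and `T_k` lies in `gam i = gam k` and
has normal direction `grad i - grad k`. -/
theorem mem_cell_iff {i : Fin 4} {x : Vec} :
    x ∈ A.cell i ↔ 0 ≤ 1 + A.gam i x ∧ ∀ j, A.gam i x ≤ A.gam j x := by
  have h : A.cell i = convexHull ℝ (Set.range (A.cellBasis i)) := rfl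
  rw [h, AffineBasis.convexHull_eq_nonneg_coord]
  simp only [cellBasis_coord, cellCoord, Set.mem_ofPred_eq]
  constructor
  · intro h
    refine ⟨by simpa using h i, fun j => ?_⟩
    rcases eq_or_ne j i with rfl | hj
    · exact le_rfl
    · have := h j
      rw [if_neg hj] at this
      have := nonneg_of_mul_nonneg_right this (A.weight_pos j)
      linarith
  · rintro ⟨h1, h2⟩ j
    split_ifs with hj
    · exact h1
    · exact mul_nonneg (A.weight_pos j).le (sub_nonneg.2 (h2 j))

theorem mem_interior_cell_iff {i : Fin 4} {x : Vec} :
    x ∈ interior (A.cell i) ↔ 0 < 1 + A.gam i x ∧ ∀ j, j ≠ i → A.gam i x < A.gam j x := by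
  have h : A.cell i = convexHull ℝ (Set.range (A.cellBasis i)) := rfl
  rw [h, AffineBasis.interior_convexHull]
  simp only [cellBasis_coord, cellCoord, Set.mem_ofPred_eq]
  constructor
  · intro h
    refine ⟨by simpa using h i, fun j hj => ?_⟩
    have := h j
    rw [if_neg hj] at this
    have := pos_of_mul_pos_right this (A.weight_pos j).le
    linarith
  · rintro ⟨h1, h2⟩ j
    split_ifs with hj
    · exact h1
    · exact mul_pos (A.weight_pos j) (sub_pos.2 (h2 j hj))

theorem mem_T_iff {x : Vec} : x ∈ A.T ↔ ∀ i, 0 ≤ 1 + A.gam i x := by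
  rw [T_eq_convexHull, AffineBasis.convexHull_eq_nonneg_coord]
  simp only [coord_eq, Set.mem_ofPred_eq]
  exact forall_congr' fun i => mul_nonneg_iff_of_pos_left (A.weight_pos i)

theorem mem_interior_T_iff {x : Vec} : x ∈ interior A.T ↔ ∀ i, 0 < 1 + A.gam i x := by
  rw [T_eq_convexHull, AffineBasis.interior_convexHull]
  simp only [coord_eq, Set.mem_ofPred_eq]
  exact forall_congr' fun i => mul_pos_iff_of_pos_left (A.weight_pos i)

theorem iUnion_cell : ⋃ i, A.cell i = A.T := by
  refine Set.Subset.antisymm (Set.iUnion_subset A.cell_subset) fun x hx => ?_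
  obtain ⟨i, hi⟩ := Finite.exists_min fun i => A.gam i x
  exact Set.mem_iUnion.2 ⟨i, A.mem_cell_iff.2 ⟨A.mem_T_iff.1 hx i, hi⟩⟩

theorem continuous_gam (i : Fin 4) : Continuous (A.gam i) := by
  unfold gam dotProduct
  fun_prop

theorem gam_add_smul (i : Fin 4) (v : Fin 3 → ℝ) :
    A.gam i (A.z + WithLp.toLp 2 v) = A.grad i ⬝ᵥ v := by
  rw [gam, add_sub_cancel_left]

theorem interior_cell_disjoint {i j : Fin 4} (h : i ≠ j) :
    Disjoint (interior (A.cell i)) (interior (A.cell j)) := by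
  rw [Set.disjoint_left]
  intro x hi hj
  have h1 := (A.mem_interior_cell_iff.1 hi).2 j h.symm
  have h2 := (A.mem_interior_cell_iff.1 hj).2 i h
  exact lt_asymm h1 h2

/-! ### The cells as an almost everywhere partition of `T` -/

theorem ae_mem_interior_cell (i : Fin 4) :
    ∀ᵐ x ∂volume.restrict (A.cell i), x ∈ interior (A.cell i) := by
  have h : volume (frontier (A.cell i)) = 0 := (convex_convexHull ℝ _).addHaar_frontier _
  rw [ae_restrict_iff' (A.isClosed_cell i).measurableSet]
  filter_upwards [compl_mem_ae_iff.2 h] with x hx hxc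
  by_contra hn
  exact hx ⟨subset_closure hxc, hn⟩

theorem aedisjoint_cell : Pairwise (Function.onFun (AEDisjoint volume) A.cell) := by
  intro i j hij
  have hi : volume (frontier (A.cell i)) = 0 := (convex_convexHull ℝ _).addHaar_frontier _
  have hj : volume (frontier (A.cell j)) = 0 := (convex_convexHull ℝ _).addHaar_frontier _
  refine measure_mono_null (fun x hx => ?_) (measure_union_null hi hj)
  by_contra hn
  rw [Set.mem_union, not_or] at hn
  have h1 : x ∈ interior (A.cell i) := by
    by_contra h; exact hn.1 ⟨subset_closure hx.1, h⟩
  have h2 : x ∈ interior (A.cell j) := by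
    by_contra h; exact hn.2 ⟨subset_closure hx.2, h⟩
  exact Set.disjoint_left.1 (A.interior_cell_disjoint hij) h1 h2

theorem vol_eq_sum : A.vol = ∑ i, volume.restrict (A.cell i) := by
  rw [vol, ← iUnion_cell, Measure.restrict_iUnion_ae A.aedisjoint_cell
    fun i => (A.isClosed_cell i).measurableSet.nullMeasurableSet, Measure.sum_fintype]

theorem ae_vol_iff {P : Vec → Prop} :
    (∀ᵐ x ∂A.vol, P x) ↔ ∀ i, ∀ᵐ x ∂volume.restrict (A.cell i), P x := by
  refine ⟨fun h i => A.ae_cell h i, fun h => ?_⟩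
  rw [vol_eq_sum, ← Measure.sum_fintype, Measure.ae_sum_iff]
  exact h

theorem integrable_cell {E : Type*} [NormedAddCommGroup E] {f : Vec → E}
    (h : Integrable f A.vol) (i : Fin 4) : IntegrableOn f (A.cell i) :=
  IntegrableOn.mono_set h (A.cell_subset i)

theorem integral_vol {E : Type*} [NormedAddCommGroup E] [NormedSpace ℝ E]
    {f : Vec → E} (h : Integrable f A.vol) :
    ∫ x, f x ∂A.vol = ∑ i, ∫ x in A.cell i, f x := by
  conv_lhs => rw [vol_eq_sum]
  exact integral_finsetSum_measure fun i _ => A.integrable_cell h i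

theorem volume_cell_pos (i : Fin 4) : 0 < volume.real (A.cell i) := by
  refine ENNReal.toReal_pos ?_ ?_
  · exact (isOpen_interior.measure_pos volume (A.interior_cell_nonempty i) |>.trans_le
      (measure_mono interior_subset)).ne'
  · exact ((Set.finite_range _).isCompact_convexHull ℝ).measure_lt_top.ne

/-! ### Linear algebra of normal continuity at a node -/

theorem ext_of_dotProduct_grad {u v : Fin 3 → ℝ} (h : ∀ i, A.grad i ⬝ᵥ u = A.grad i ⬝ᵥ v) :
    u = v := by
  rw [← A.sum_smul_vtx u, ← A.sum_smul_vtx v]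
  exact Finset.sum_congr rfl fun i _ => by rw [h]

theorem dotProduct_mulVec_comm_of_isSymm {S : Mat} (hS : S.IsSymm) (u v : Fin 3 → ℝ) :
    u ⬝ᵥ S *ᵥ v = v ⬝ᵥ S *ᵥ u := by
  rw [dotProduct_mulVec, ← mulVec_transpose, hS.eq, dotProduct_comm]

/-- Symmetric matrices on the three cells around the vertex `x_k` that annihilate the boundary
normals and have continuous normal components vanish. -/
theorem eq_zero_of_normal_continuous {S : Fin 4 → Mat} {k : Fin 4} (hS : ∀ i, (S i).IsSymm)
    (h0 : ∀ i, i ≠ k → S i *ᵥ A.grad i = 0)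
    (hc : ∀ i j, i ≠ k → j ≠ k → (S i - S j) *ᵥ (A.grad i - A.grad j) = 0)
    {i : Fin 4} (hi : i ≠ k) : S i = 0 := by
  have B0 : ∀ i, i ≠ k → ∀ a, A.grad a ⬝ᵥ S i *ᵥ A.grad i = 0 := fun i hi a => by
    rw [h0 i hi, dotProduct_zero]
  have Bs : ∀ i a b, A.grad a ⬝ᵥ S i *ᵥ A.grad b = A.grad b ⬝ᵥ S i *ᵥ A.grad a := fun i a b =>
    dotProduct_mulVec_comm_of_isSymm (hS i) _ _
  have Bc : ∀ i j, i ≠ k → j ≠ k → ∀ a,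
      A.grad a ⬝ᵥ S i *ᵥ A.grad j = - (A.grad a ⬝ᵥ S j *ᵥ A.grad i) := by
    intro i j hi hj a
    have h := congrArg (A.grad a ⬝ᵥ ·) (hc i j hi hj)
    simp only [sub_mulVec, mulVec_sub, dotProduct_sub, dotProduct_zero] at h
    have h1 := B0 i hi a
    have h2 := B0 j hj a
    linarith
  -- Exchanging the last two indices changes nothing (`Bs`), exchanging cell index and last index
  -- changes the sign (`Bc`). Alternating the two three times returns to the start with the opposite
  -- sign.
  have B3 : ∀ a, a ≠ k → ∀ b, b ≠ k → A.grad a ⬝ᵥ S i *ᵥ A.grad b = 0 := by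
    intro a ha b hb
    have h1 := Bc i b hi hb a
    have h2 := Bs b a i
    have h3 := Bc b a hb ha i
    have h4 := Bs a i b
    have h5 := Bc a i ha hi b
    have h6 := Bs i b a
    linarith
  -- The remaining gradient `grad k` is a combination of the other three, because `∑ w_i g_i = 0`.
  have B4 : ∀ a, a ≠ k → ∀ b, A.grad a ⬝ᵥ S i *ᵥ A.grad b = 0 := by
    intro a ha b
    rcases eq_or_ne b k with rfl | hb
    · have h := congrArg (fun v => A.grad a ⬝ᵥ S i *ᵥ v) A.sum_weight_smul_grad
      simp only [mulVec_sum, mulVec_smul, dotProduct_sum, dotProduct_smul, mulVec_zero,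
        dotProduct_zero, smul_eq_mul] at h
      rw [Finset.sum_eq_single b (fun c _ hc => by rw [B3 a ha c hc, mul_zero]) (by simp)] at h
      exact (mul_eq_zero.1 h).resolve_left (A.weight_pos b).ne'
    · exact B3 a ha b hb
  have B5 : ∀ a b, A.grad a ⬝ᵥ S i *ᵥ A.grad b = 0 := by
    intro a b
    rcases eq_or_ne a k with rfl | ha
    · have h := congrArg (fun v => v ⬝ᵥ S i *ᵥ A.grad b) A.sum_weight_smul_grad
      simp only [sum_dotProduct, smul_dotProduct, zero_dotProduct, smul_eq_mul] at h
      rw [Finset.sum_eq_single a (fun c _ hc => by rw [B4 c hc b, mul_zero]) (by simp)] at h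
      exact (mul_eq_zero.1 h).resolve_left (A.weight_pos a).ne'
    · exact B4 a ha b
  have B6 : ∀ b, S i *ᵥ A.grad b = 0 := fun b =>
    A.ext_of_dotProduct_grad fun a => by rw [B5 a b, dotProduct_zero]
  refine ext_of_mulVec_single fun c => ?_
  rw [← A.sum_smul_grad (Pi.single c 1), mulVec_sum]
  simp [mulVec_smul, B6]

/-- Discrete form of `∫ div σ = 0` and `∫ div σ ⊗ (x - z) = -∫ σ` for the field `σ` equal to `S i`
times the hat function on `T_i`, the volume of `T_i` being proportional to `w_i`. Both follow by
averaging the jump relation `hd` over pairs of cells with weights `w_i w_j`, the second after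
tensoring with `x_j - z`. -/
theorem sum_mulVec_grad_outer {S : Fin 4 → Mat}
    (hc : ∀ i j, (S i - S j) *ᵥ (A.grad i - A.grad j) = 0) :
    ∑ i, A.weight i • S i *ᵥ A.grad i = 0 ∧
      ∑ i, A.weight i • vecMulVec (S i *ᵥ A.grad i) (A.vtx i) = ∑ i, A.weight i • S i := by
  have hd : ∀ i j, S i *ᵥ A.grad i + S j *ᵥ A.grad j =
      S i *ᵥ A.grad j + S j *ᵥ A.grad i := by
    intro i j
    have h := hc i j
    simp only [sub_mulVec, mulVec_sub] at h
    rw [← sub_eq_zero, ← h]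
    abel
  have s1 : ∑ i, A.weight i • S i *ᵥ A.grad i = 0 := by
    have h : ∀ i, S i *ᵥ A.grad i + ∑ j, A.weight j • S j *ᵥ A.grad j =
        ∑ j, A.weight j • S j *ᵥ A.grad i := by
      intro i
      have e : ∑ j, A.weight j • (S i *ᵥ A.grad i + S j *ᵥ A.grad j) =
        ∑ j, A.weight j • (S i *ᵥ A.grad j + S j *ᵥ A.grad i) :=
          Finset.sum_congr rfl fun j _ => by rw [hd i j]
      simp only [smul_add, Finset.sum_add_distrib, ← Finset.sum_smul, sum_weight, one_smul] at e
      rw [e]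
      simp only [← mulVec_smul, ← mulVec_sum, sum_weight_smul_grad, mulVec_zero, zero_add]
    have e : ∑ i, A.weight i • (S i *ᵥ A.grad i + ∑ j, A.weight j • S j *ᵥ A.grad j) =
        ∑ i, A.weight i • ∑ j, A.weight j • S j *ᵥ A.grad i := by simp only [h]
    simp only [smul_add, Finset.sum_add_distrib, ← Finset.sum_smul, sum_weight, one_smul] at e
    have e2 : ∑ i, A.weight i • ∑ j, A.weight j • S j *ᵥ A.grad i = 0 := by
      simp only [Finset.smul_sum]
      rw [Finset.sum_comm]
      refine Finset.sum_eq_zero fun j _ => ?_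
      simp only [smul_comm (A.weight _) (A.weight j), ← Finset.smul_sum, ← mulVec_smul,
        ← mulVec_sum, sum_weight_smul_grad, mulVec_zero, smul_zero]
    rw [e2, ← two_smul ℝ] at e
    exact (smul_eq_zero.1 e).resolve_left two_ne_zero
  refine ⟨s1, ?_⟩
  have h1 : ∀ i, ∑ j, A.weight j • vecMulVec (S i *ᵥ A.grad j) (A.vtx j) = S i := by
    intro i
    refine ext_of_mulVec_single fun c => ?_
    conv_rhs => rw [← A.sum_smul_grad (Pi.single c 1)]
    simp only [sum_mulVec, mulVec_sum, smul_mulVec, mulVec_smul, vecMulVec_mulVec]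
    refine Finset.sum_congr rfl fun j _ => ?_
    ext r
    simp
    ring
  have e : ∑ i, ∑ j, (A.weight i * A.weight j) •
        vecMulVec (S i *ᵥ A.grad i + S j *ᵥ A.grad j) (A.vtx j) =
      ∑ i, ∑ j, (A.weight i * A.weight j) •
        vecMulVec (S i *ᵥ A.grad j + S j *ᵥ A.grad i) (A.vtx j) :=
    Finset.sum_congr rfl fun i _ => Finset.sum_congr rfl fun j _ => by rw [hd i j]
  simp only [add_vecMulVec, smul_add, Finset.sum_add_distrib] at e
  -- Of the four double sums, `t1` vanishes by `∑ w_j (x_j - z) = 0` and `t4` by `∑ w_i g_i = 0`;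
  -- `t2` and `t3` are the two sides of the claim.
  have t1 : ∑ i, ∑ j, (A.weight i * A.weight j) • vecMulVec (S i *ᵥ A.grad i) (A.vtx j) = 0 := by
    refine Finset.sum_eq_zero fun i _ => ?_
    ext p q
    have h := congrFun A.sum_weight_smul_vtx q
    simp only [Finset.sum_apply, Pi.smul_apply, smul_eq_mul, Pi.zero_apply] at h
    simp only [Matrix.sum_apply, Matrix.smul_apply, vecMulVec_apply, smul_eq_mul, Matrix.zero_apply]
    rw [← mul_zero (A.weight i * (S i *ᵥ A.grad i) p), ← h, Finset.mul_sum]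
    exact Finset.sum_congr rfl fun j _ => by ring
  have t2 : ∑ i, ∑ j, (A.weight i * A.weight j) • vecMulVec (S j *ᵥ A.grad j) (A.vtx j) =
      ∑ j, A.weight j • vecMulVec (S j *ᵥ A.grad j) (A.vtx j) := by
    simp only [mul_smul, ← Finset.smul_sum, ← Finset.sum_smul, sum_weight, one_smul]
  have t3 : ∑ i, ∑ j, (A.weight i * A.weight j) • vecMulVec (S i *ᵥ A.grad j) (A.vtx j) =
      ∑ i, A.weight i • S i := by
    simp only [mul_smul, ← Finset.smul_sum, h1]
  have t4 : ∑ i, ∑ j, (A.weight i * A.weight j) • vecMulVec (S j *ᵥ A.grad i) (A.vtx j) = 0 := by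
    rw [Finset.sum_comm]
    refine Finset.sum_eq_zero fun j _ => ?_
    ext p q
    have h := congrFun (congrArg (S j *ᵥ ·) A.sum_weight_smul_grad) p
    simp only [mulVec_sum, mulVec_smul, mulVec_zero, Finset.sum_apply, Pi.smul_apply, smul_eq_mul,
      Pi.zero_apply] at h
    simp only [Matrix.sum_apply, Matrix.smul_apply, vecMulVec_apply, smul_eq_mul, Matrix.zero_apply]
    rw [← mul_zero (A.weight j * A.vtx j q), ← h, Finset.mul_sum]
    exact Finset.sum_congr rfl fun i _ => by ring
  rw [t1, t2, t3, t4, zero_add, add_zero] at e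
  exact e

/-- A rigid displacement whose values at the barycenters of the cells are the divergences of a
continuous stress without boundary traction vanishes. -/
theorem rigid_eq_zero_of_energy {S : Fin 4 → Mat} (hS : ∀ i, (S i).IsSymm)
    (hc : ∀ i j, (S i - S j) *ᵥ (A.grad i - A.grad j) = 0) {a b c₀ : Fin 3 → ℝ} {t : ℝ}
    (ht : t ≠ 0)
    (hr : ∀ i, S i *ᵥ A.grad i = a + crossProduct b (c₀ + t • A.vtx i)) :
    a = 0 ∧ b = 0 := by
  obtain ⟨s1, s2⟩ := A.sum_mulVec_grad_outer hc
  have hsym : (∑ i, A.weight i • S i).IsSymm := by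
    rw [Matrix.IsSymm, transpose_sum]
    exact Finset.sum_congr rfl fun i _ => ((hS i).smul _).eq
  rw [← s2] at hsym
  set u : Fin 4 → Fin 3 → ℝ := fun i => S i *ᵥ A.grad i with hu
  have hN : ∀ p q, ∑ i, A.weight i * (u i p * A.vtx i q) =
      ∑ i, A.weight i * (u i q * A.vtx i p) := by
    intro p q
    have := hsym.apply q p
    simpa [Matrix.sum_apply, vecMulVec_apply] using this
  -- Moment balance: `v ↦ b × v` is skew, so its pairing with a symmetric matrix is zero.
  have hcr : ∑ i, A.weight i * (u i ⬝ᵥ crossProduct b (A.vtx i)) = 0 := by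
    have h1 := hN 0 1
    have h2 := hN 0 2
    have h3 := hN 1 2
    simp only [cross_apply, vec3_dotProduct, Fin.sum_univ_four, Matrix.cons_val] at h1 h2 h3 ⊢
    linear_combination b 2 * (-h1) + b 1 * h2 - b 0 * h3
  -- One factor `u i` is replaced by the rigid displacement: its constant part is killed by force
  -- balance `s1`, its part linear in `vtx i` by `hcr`.
  have hE : ∑ i, A.weight i * (u i ⬝ᵥ u i) = 0 := by
    have e : ∀ i, A.weight i * (u i ⬝ᵥ u i) = (A.weight i • u i) ⬝ᵥ (a + crossProduct b c₀) +
        t * (A.weight i * (u i ⬝ᵥ crossProduct b (A.vtx i))) := by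
      intro i
      have : u i = a + crossProduct b (c₀ + t • A.vtx i) := hr i
      conv_lhs => rw [dotProduct_comm]; enter [2, 1]; rw [this]
      rw [map_add, map_smul, ← add_assoc, add_dotProduct, smul_dotProduct, smul_dotProduct,
        dotProduct_comm, dotProduct_comm (crossProduct b (A.vtx i))]
      simp only [smul_eq_mul]
      ring
    simp only [e, Finset.sum_add_distrib, ← Finset.mul_sum, hcr, ← sum_dotProduct]
    rw [s1]
    simp
  have hn : ∀ v : Fin 3 → ℝ, 0 ≤ v ⬝ᵥ v := fun v =>
    Finset.sum_nonneg fun c _ => mul_self_nonneg (v c)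
  have hu0 : ∀ i, u i = 0 := by
    intro i
    have h := (Finset.sum_eq_zero_iff_of_nonneg fun i _ =>
      mul_nonneg (A.weight_pos i).le (hn (u i))).1 hE i (Finset.mem_univ i)
    exact dotProduct_self_eq_zero.1 ((mul_eq_zero.1 h).resolve_left (A.weight_pos i).ne')
  have hr' : ∀ i, a + crossProduct b c₀ + t • crossProduct b (A.vtx i) = 0 := by
    intro i
    rw [add_assoc, ← map_smul, ← map_add, ← hr i]
    exact hu0 i
  -- The weighted average removes the terms in `vtx i`.
  have h0 : a + crossProduct b c₀ = 0 := by
    have h : ∑ i, A.weight i • (a + crossProduct b c₀ + t • crossProduct b (A.vtx i)) = 0 := by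
      simp [hr']
    simp only [smul_add, Finset.sum_add_distrib, ← Finset.sum_smul, sum_weight, one_smul,
      smul_comm (A.weight _) t, ← Finset.smul_sum] at h
    simp only [← map_smul, ← map_sum, sum_weight_smul_vtx] at h
    simpa using h
  have hb : ∀ i, crossProduct b (A.vtx i) = 0 := fun i => by
    have := hr' i
    rw [h0, zero_add] at this
    exact (smul_eq_zero.1 this).resolve_left ht
  have hb' : ∀ v, crossProduct b v = 0 := fun v => by
    rw [← A.sum_smul_vtx v, map_sum]
    simp [hb]
  have b0 : b = 0 := by
    have h1 := congrFun (hb' ![1, 0, 0]) 1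
    have h2 := congrFun (hb' ![1, 0, 0]) 2
    have h3 := congrFun (hb' ![0, 1, 0]) 2
    simp [cross_apply] at h1 h2 h3
    ext i
    fin_cases i
    · exact h3
    · exact h2
    · exact h1
  subst b0
  exact ⟨by simpa using h0, rfl⟩

/-! ### The square linear system for the nodal values -/

/-- The barycenter of the cell `T_i`. -/
def center (i : Fin 4) : Vec := (4⁻¹ : ℝ) • ∑ j, A.cellBasis i j

/-- Replacing `x_i` by `z` shifts the vertex average by `-(x_i - z)/4`. This is the form `c₀ + t •
vtx i` with `t ≠ 0` that the energy argument needs. -/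
theorem center_eq (i : Fin 4) :
    (A.center i).ofLp = (A.z.ofLp + (4⁻¹ : ℝ) • ∑ j, A.vtx j) + (-4⁻¹ : ℝ) • A.vtx i := by
  have h : ∑ j, A.cellBasis i j = ∑ j, A.simplex.points j + (A.z - A.simplex.points i) := by
    simp only [cellBasis_apply]
    rw [Finset.sum_update_of_mem (Finset.mem_univ i), Finset.sdiff_singleton_eq_erase,
      Finset.sum_erase_eq_sub (Finset.mem_univ i)]
    abel
  rw [center, h]
  ext c
  simp [vtx]
  ring

/-- The divergence of the affine matrix field on `T_i` with value `E j` at the vertex `x_j` for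
`j ≠ i` and `E i` at the split point. -/
def nodalDiv (i : Fin 4) (E : Fin 4 → Mat) : Fin 3 → ℝ :=
  E i *ᵥ A.grad i + ∑ m, A.weight m • E m *ᵥ (A.grad m - A.grad i)

/-- Nodal values of a symmetric piecewise affine matrix field with continuous normal components
(the node `i` of the cell `T_i` being the split point) whose divergence is piecewise equal to the
values at the cell centers of the rigid displacement `x ↦ a + b × x`. -/
structure IsNodalStress (E : Fin 4 → Fin 4 → Mat) (a b : Fin 3 → ℝ) : Prop where
  symm : ∀ i m, (E i m).IsSymm
  cont_vertex : ∀ i k m, m ≠ i → m ≠ k → (E i m - E k m) *ᵥ (A.grad i - A.grad k) = 0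
  cont_split : ∀ i k, (E i i - E k k) *ᵥ (A.grad i - A.grad k) = 0
  div_eq : ∀ i, A.nodalDiv i (E i) = a + crossProduct b (A.center i).ofLp

-- Uniqueness for the nodal system. The outer nodes are treated one at a time. Once their values
-- vanish, the divergence on `T_i` reduces to `E i i *ᵥ grad i`, and the energy argument applies to
-- the values at the split point.
variable {A} in
theorem IsNodalStress.eq_zero {E : Fin 4 → Fin 4 → Mat} {a b : Fin 3 → ℝ}
    (h : A.IsNodalStress E a b) (h0 : ∀ i m, m ≠ i → E i m *ᵥ A.grad i = 0) :
    (∀ i m, E i m = 0) ∧ a = 0 ∧ b = 0 := by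
  have hv : ∀ i m, m ≠ i → E i m = 0 := fun i m him =>
    A.eq_zero_of_normal_continuous (S := fun i => E i m) (fun i => h.symm i m)
      (fun i hi => h0 i m hi.symm) (fun i j hi hj => h.cont_vertex i j m hi.symm hj.symm) him.symm
  have hd : ∀ i, E i i *ᵥ A.grad i = a + crossProduct b (A.center i).ofLp := by
    intro i
    rw [← h.div_eq i, nodalDiv, Finset.sum_eq_zero, add_zero]
    intro m _
    rcases eq_or_ne m i with rfl | hm
    · rw [sub_self, mulVec_zero, smul_zero]
    · rw [hv i m hm, zero_mulVec, smul_zero]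
  obtain ⟨ha, hb⟩ := A.rigid_eq_zero_of_energy (S := fun i => E i i) (fun i => h.symm i i)
    h.cont_split (t := -4⁻¹) (by norm_num) fun i => by rw [hd i, center_eq]
  subst ha hb
  refine ⟨fun i m => ?_, rfl, rfl⟩
  rcases eq_or_ne m i with rfl | hm
  -- With `a = b = 0` the matrices at the split point annihilate their own gradients, so the vertex
  -- lemma applies to any three of the four cells; `k` is the omitted one.
  · obtain ⟨k, hk⟩ := exists_ne m
    exact A.eq_zero_of_normal_continuous (S := fun i => E i i) (fun i => h.symm i i)
      (fun i _ => by rw [hd i]; simp) (fun i j _ _ => h.cont_split i j) hk.symm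
  · exact hv i m hm

/-- The symmetric matrix with prescribed entries. -/
def symMat : (Sym2 (Fin 3) → ℝ) →ₗ[ℝ] Mat where
  toFun f := Matrix.of fun a b => f s(a, b)
  map_add' _ _ := rfl
  map_smul' _ _ := rfl

theorem symMat_isSymm (f : Sym2 (Fin 3) → ℝ) : (symMat f).IsSymm := by
  ext a b
  exact congrArg f Sym2.eq_swap

theorem symMat_injective : Function.Injective symMat := by
  intro f f' h
  ext s
  induction s with
  | _ a b => exact congrFun (congrFun h a) b

/-- Index set for the conditions of normal continuity: a pair of cells `T_i`, `T_k` and a node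
of their common facet, `m = i` standing for the split point. -/
abbrev ContIdx : Type := {q : Fin 4 × Fin 4 × Fin 4 // q.1 < q.2.1 ∧ q.2.2 ≠ q.2.1}

/-- Index set for the boundary conditions: a facet `F_i` and one of its vertices. -/
abbrev BdryIdx : Type := {q : Fin 4 × Fin 4 // q.2 ≠ q.1}

/-- The linear system for the nodal values of a stress with prescribed boundary values. -/
def nodalSystem : ((Fin 4 → Fin 4 → Sym2 (Fin 3) → ℝ) × (Fin 3 → ℝ) × (Fin 3 → ℝ)) →ₗ[ℝ]
    ((ContIdx → Fin 3 → ℝ) × (Fin 4 → Fin 3 → ℝ) × (BdryIdx → Fin 3 → ℝ)) where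
  toFun X :=
    (fun q => (symMat (X.1 q.1.1 q.1.2.2) -
        -- The split point is node `i` of `T_i` but node `k` of `T_k`; every other common node has
        -- the same index in both cells.
        symMat (X.1 q.1.2.1 (if q.1.2.2 = q.1.1 then q.1.2.1 else q.1.2.2))) *ᵥ
          (A.grad q.1.1 - A.grad q.1.2.1),
      fun i => A.nodalDiv i (fun m => symMat (X.1 i m)) -
        (X.2.1 + crossProduct X.2.2 (A.center i).ofLp),
      fun q => symMat (X.1 q.1.1 q.1.2) *ᵥ A.grad q.1.1)
  map_add' X Y := by
    refine Prod.ext ?_ (Prod.ext ?_ ?_)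
    · ext1 q
      simp only [Prod.fst_add, Pi.add_apply, map_add, ← add_mulVec]
      congr 1
      abel
    · ext1 i
      simp only [Prod.fst_add, Prod.snd_add, Pi.add_apply, map_add, nodalDiv, add_mulVec, smul_add,
        Finset.sum_add_distrib, LinearMap.add_apply]
      abel
    · ext1 q
      simp only [Prod.fst_add, Prod.snd_add, Pi.add_apply, map_add, add_mulVec]
  map_smul' c X := by
    refine Prod.ext ?_ (Prod.ext ?_ ?_)
    · ext1 q
      simp only [Prod.smul_fst, Pi.smul_apply, map_smul, ← smul_sub, smul_mulVec,
        RingHom.id_apply]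
    · ext1 i
      simp only [Prod.smul_fst, Prod.smul_snd, Pi.smul_apply, map_smul, nodalDiv, smul_mulVec,
        LinearMap.smul_apply, RingHom.id_apply, smul_sub, smul_add, Finset.smul_sum,
        smul_comm c (A.weight _)]
    · ext1 q
      simp only [Prod.smul_fst, Prod.smul_snd, Pi.smul_apply, map_smul, smul_mulVec,
        RingHom.id_apply]

theorem isNodalStress_of_nodalSystem {X} (h1 : (A.nodalSystem X).1 = 0)
    (h2 : (A.nodalSystem X).2.1 = 0) :
    A.IsNodalStress (fun i m => symMat (X.1 i m)) X.2.1 X.2.2 := by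
  have hlt : ∀ i k : Fin 4, i < k → ∀ m, m ≠ k → (symMat (X.1 i m) -
      symMat (X.1 k (if m = i then k else m))) *ᵥ (A.grad i - A.grad k) = 0 :=
    fun i k hik m hmk => congrFun h1 ⟨(i, k, m), hik, hmk⟩
  refine ⟨fun i m => symMat_isSymm _, fun i k m hi hk => ?_, fun i k => ?_, fun i => ?_⟩
  · rcases lt_trichotomy i k with h | rfl | h
    · have := hlt i k h m hk
      rwa [if_neg hi] at this
    · rw [sub_self, zero_mulVec]
    · have := hlt k i h m hi
      rw [if_neg hk] at this
      rw [← neg_sub (symMat _), ← neg_sub (A.grad k), neg_mulVec_neg]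
      exact this
  · rcases lt_trichotomy i k with h | rfl | h
    · have := hlt i k h i h.ne
      rwa [if_pos rfl] at this
    · rw [sub_self, zero_mulVec]
    · have := hlt k i h k h.ne
      rw [if_pos rfl] at this
      rw [← neg_sub (symMat _), ← neg_sub (A.grad k), neg_mulVec_neg]
      exact this
  · exact sub_eq_zero.1 (congrFun h2 i)

theorem nodalSystem_surjective : Function.Surjective A.nodalSystem := by
  have hinj : Function.Injective A.nodalSystem := by
    rw [injective_iff_map_eq_zero]
    intro X hX
    have h := A.isNodalStress_of_nodalSystem (X := X) (by rw [hX]; rfl) (by rw [hX]; rfl)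
    obtain ⟨h1, h2, h3⟩ := h.eq_zero fun i m him =>
      congrFun (congrArg (fun Y => Y.2.2) hX) ⟨(i, m), him⟩
    refine Prod.ext ?_ (Prod.ext h2 h3)
    ext1 i
    ext1 m
    exact symMat_injective ((h1 i m).trans (map_zero symMat).symm)
  -- Dimensions: 16·6 + 3 + 3 = 102 unknowns, and 18·3 + 4·3 + 12·3 = 102 equations.
  refine (LinearMap.injective_iff_surjective_of_finrank_eq_finrank ?_).1 hinj
  have c1 : Fintype.card ContIdx = 18 := by decide
  have c2 : Fintype.card BdryIdx = 12 := by decide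
  have c3 : Fintype.card (Sym2 (Fin 3)) = 6 := by decide
  simp [Module.finrank_pi_fintype, c1, c2, c3]

theorem exists_isNodalStress (t : Fin 4 → Fin 4 → Fin 3 → ℝ) :
    ∃ E a b, A.IsNodalStress E a b ∧ ∀ i m, m ≠ i → E i m *ᵥ A.grad i = t i m := by
  obtain ⟨X, hX⟩ := A.nodalSystem_surjective (0, 0, fun q => t q.1.1 q.1.2)
  refine ⟨_, _, _, A.isNodalStress_of_nodalSystem (X := X) (by rw [hX]) (by rw [hX]),
    fun i m him => ?_⟩
  exact congrFun (congrArg (fun Y => Y.2.2) hX) ⟨(i, m), him⟩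

/-! ### Linear parametrization of the cells and change of variables -/

/-- The matrix whose columns are the edges of `T_i` that emanate from the split point. -/
def frame (i : Fin 4) : Mat := Matrix.of fun c m => A.vtx (i.succAbove m) c

/-- The dual frame of `frame i`. -/
def coframe (i : Fin 4) (m : Fin 3) : Fin 3 → ℝ :=
  A.weight (i.succAbove m) • (A.grad (i.succAbove m) - A.grad i)

theorem frame_mulVec (i : Fin 4) (s : Fin 3 → ℝ) :
    A.frame i *ᵥ s = ∑ m, s m • A.vtx (i.succAbove m) := by
  ext c
  simp [frame, mulVec, dotProduct, mul_comm]

theorem grad_dot_frame (i : Fin 4) (s : Fin 3 → ℝ) : A.grad i ⬝ᵥ A.frame i *ᵥ s = -∑ m, s m := by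
  simp [frame_mulVec, dotProduct_sum, dotProduct_smul, grad_dot_vtx, (Fin.succAbove_ne _ _).symm]

theorem grad_succAbove_dot_frame (i : Fin 4) (m : Fin 3) (s : Fin 3 → ℝ) :
    A.grad (i.succAbove m) ⬝ᵥ A.frame i *ᵥ s = (A.weight (i.succAbove m))⁻¹ * s m - ∑ m, s m := by
  simp only [frame_mulVec, dotProduct_sum, dotProduct_smul, grad_dot_vtx,
    Fin.succAbove_right_inj, smul_eq_mul, mul_sub, Finset.sum_sub_distrib, mul_one]
  simp [mul_comm]

theorem coframe_dot_frame (i : Fin 4) (m : Fin 3) (s : Fin 3 → ℝ) :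
    A.coframe i m ⬝ᵥ A.frame i *ᵥ s = s m := by
  have := (A.weight_pos (i.succAbove m)).ne'
  rw [coframe, smul_dotProduct, sub_dotProduct, grad_succAbove_dot_frame, grad_dot_frame,
    smul_eq_mul]
  field_simp
  ring

theorem coframe_mul_frame (i : Fin 4) : (Matrix.of (A.coframe i)) * A.frame i = 1 := by
  refine ext_of_mulVec_single fun c => ?_
  rw [← mulVec_mulVec, one_mulVec]
  ext m
  exact A.coframe_dot_frame i m _

theorem det_frame_ne_zero (i : Fin 4) : (A.frame i).det ≠ 0 := by
  have h := congrArg det (A.coframe_mul_frame i)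
  rw [det_mul, det_one] at h
  exact right_ne_zero_of_mul_eq_one h

theorem sum_coframe_smul (i : Fin 4) (v : Fin 3 → ℝ) :
    ∑ m, (A.coframe i m ⬝ᵥ v) • A.vtx (i.succAbove m) = v := by
  have h : A.frame i * Matrix.of (A.coframe i) = 1 := mul_eq_one_comm.1 (A.coframe_mul_frame i)
  have h2 := congrArg (· *ᵥ v) h
  simp only [← mulVec_mulVec, one_mulVec, frame_mulVec] at h2
  exact h2

/-- The cell volumes are proportional to the weights. Taking the scalar product of `∑ w_j (x_j - z)
= 0` with the cross product of the two vectors with indices other than `0` and `i` leaves two terms,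
which are the two determinants up to sign. -/
theorem det_frame (i : Fin 4) :
    A.weight 0 * |(A.frame i).det| = A.weight i * |(A.frame 0).det| := by
  have hy : ∀ c, A.weight 0 * A.vtx 0 c + A.weight 1 * A.vtx 1 c + A.weight 2 * A.vtx 2 c +
      A.weight 3 * A.vtx 3 c = 0 := fun c => by
    have := congrFun A.sum_weight_smul_vtx c
    simpa [Fin.sum_univ_four] using this
  suffices h : A.weight 0 * (A.frame i).det = A.weight i * (A.frame 0).det ∨
      A.weight 0 * (A.frame i).det = -(A.weight i * (A.frame 0).det) by
    rw [← abs_of_pos (A.weight_pos 0), ← abs_of_pos (A.weight_pos i), ← abs_mul, ← abs_mul]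
    exact abs_eq_abs.2 h
  have e : ∀ i c m, A.frame i c m = A.vtx (i.succAbove m) c := fun _ _ _ => rfl
  have s10 : (1 : Fin 4).succAbove (0 : Fin 3) = 0 := by decide
  have s11 : (1 : Fin 4).succAbove (1 : Fin 3) = 2 := by decide
  have s12 : (1 : Fin 4).succAbove (2 : Fin 3) = 3 := by decide
  have s20 : (2 : Fin 4).succAbove (0 : Fin 3) = 0 := by decide
  have s21 : (2 : Fin 4).succAbove (1 : Fin 3) = 1 := by decide
  have s22 : (2 : Fin 4).succAbove (2 : Fin 3) = 3 := by decide
  have s30 : (3 : Fin 4).succAbove (0 : Fin 3) = 0 := by decide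
  have s31 : (3 : Fin 4).succAbove (1 : Fin 3) = 1 := by decide
  have s32 : (3 : Fin 4).succAbove (2 : Fin 3) = 2 := by decide
  have s00 : (0 : Fin 4).succAbove (0 : Fin 3) = 1 := by decide
  have s01 : (0 : Fin 4).succAbove (1 : Fin 3) = 2 := by decide
  have s02 : (0 : Fin 4).succAbove (2 : Fin 3) = 3 := by decide
  have cr : ∀ j k : Fin 4, A.weight 0 * (A.vtx 0 ⬝ᵥ crossProduct (A.vtx j) (A.vtx k)) +
      A.weight 1 * (A.vtx 1 ⬝ᵥ crossProduct (A.vtx j) (A.vtx k)) +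
      A.weight 2 * (A.vtx 2 ⬝ᵥ crossProduct (A.vtx j) (A.vtx k)) +
      A.weight 3 * (A.vtx 3 ⬝ᵥ crossProduct (A.vtx j) (A.vtx k)) = 0 := by
    intro j k
    simp only [cross_apply, vec3_dotProduct, Matrix.cons_val]
    linear_combination (A.vtx j 1 * A.vtx k 2 - A.vtx j 2 * A.vtx k 1) * hy 0 +
      (A.vtx j 2 * A.vtx k 0 - A.vtx j 0 * A.vtx k 2) * hy 1 +
      (A.vtx j 0 * A.vtx k 1 - A.vtx j 1 * A.vtx k 0) * hy 2
  have h23 := cr 2 3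
  have h13 := cr 1 3
  have h12 := cr 1 2
  simp only [cross_apply, vec3_dotProduct, Matrix.cons_val] at h23 h13 h12
  fin_cases i
  · exact Or.inl rfl
  · right
    simp only [det_fin_three, e, Fin.mk_one, s10, s11, s12, s00, s01, s02]
    linear_combination h23
  · left
    simp only [det_fin_three, e, Fin.reduceFinMk, s20, s21, s22, s00, s01, s02]
    linear_combination h13
  · right
    simp only [det_fin_three, e, Fin.reduceFinMk, s30, s31, s32, s00, s01, s02]
    linear_combination h12

/-- The common factor of the face normals. -/
def faceFactor : ℝ := |(A.frame 0).det| / A.weight 0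

theorem faceFactor_pos : 0 < A.faceFactor :=
  div_pos (abs_pos.2 (A.det_frame_ne_zero 0)) (A.weight_pos 0)

/-- Consequently `|det (frame i)| • coframe i m` equals `faceFactor * w_i * w_k • (g_k - g_i)` with
`k = i.succAbove m`. This is antisymmetric in `i, k`, so the boundary terms from the two sides of a
face combine into a jump. -/
theorem abs_det_frame (i : Fin 4) : |(A.frame i).det| = A.faceFactor * A.weight i := by
  have := A.det_frame i
  have hw := (A.weight_pos 0).ne'
  rw [faceFactor]
  field_simp
  linarith

/-- The linear parametrization of the cone over the cell `T_i`. -/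
def param (i : Fin 4) (s : Fin 3 → ℝ) : Vec := A.z + WithLp.toLp 2 (A.frame i *ᵥ s)

theorem gam_param (i : Fin 4) (s : Fin 3 → ℝ) : A.gam i (A.param i s) = -∑ m, s m := by
  rw [param, gam_add_smul, grad_dot_frame]

theorem gam_param_succAbove (i : Fin 4) (m : Fin 3) (s : Fin 3 → ℝ) :
    A.gam (i.succAbove m) (A.param i s) = (A.weight (i.succAbove m))⁻¹ * s m - ∑ m, s m := by
  rw [param, gam_add_smul, grad_succAbove_dot_frame]

theorem continuous_param (i : Fin 4) : Continuous (A.param i) := by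
  unfold param
  fun_prop

theorem param_mem_cell_iff (i : Fin 4) (s : Fin 3 → ℝ) :
    A.param i s ∈ A.cell i ↔ (∀ m, 0 ≤ s m) ∧ ∑ m, s m ≤ 1 := by
  rw [mem_cell_iff, gam_param]
  constructor
  · rintro ⟨h1, h2⟩
    refine ⟨fun m => ?_, by linarith⟩
    have h := h2 (i.succAbove m)
    rw [gam_param_succAbove] at h
    exact nonneg_of_mul_nonneg_right (a := (A.weight (i.succAbove m))⁻¹) (by linarith)
      (inv_pos.2 (A.weight_pos _))
  · rintro ⟨h1, h2⟩
    refine ⟨by linarith, fun j => ?_⟩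
    rcases eq_or_ne j i with rfl | hj
    · rw [gam_param]
    · obtain ⟨m, rfl⟩ := Fin.exists_succAbove_eq hj
      rw [gam_param_succAbove]
      have := mul_nonneg (inv_pos.2 (A.weight_pos (i.succAbove m))).le (h1 m)
      linarith

theorem sum_lt_one_of_param_mem {i : Fin 4} {s : Fin 3 → ℝ} (h : A.param i s ∈ interior A.T) :
    ∑ m, s m < 1 := by
  have := A.mem_interior_T_iff.1 h i
  rw [gam_param] at this
  linarith

theorem integral_frame (i : Fin 4) (F : Vec → ℝ) :
    ∫ x, F x = |(A.frame i).det| * ∫ s : Fin 3 → ℝ, F (A.param i s) := by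
  have h1 : ∫ x, F x = ∫ s : Fin 3 → ℝ, F (A.z + WithLp.toLp 2 s) := by
    rw [← integral_add_left_eq_self F A.z]
    exact ((PiLp.volume_preserving_toLp (Fin 3)).integral_comp
      (MeasurableEquiv.toLp 2 (Fin 3 → ℝ)).measurableEmbedding (fun x => F (A.z + x))).symm
  have hd := A.det_frame_ne_zero i
  have h2 := Real.map_matrix_volume_pi_eq_smul_volume_pi hd
  have hu : IsUnit (A.frame i).det := isUnit_iff_ne_zero.2 hd
  have he : MeasurableEmbedding (Matrix.toLin' (A.frame i)) := by
    have : Function.Injective (Matrix.toLin' (A.frame i)) := by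
      intro s s' h
      ext m
      rw [← A.coframe_dot_frame i m s, ← A.coframe_dot_frame i m s']
      exact congrArg _ h
    exact ((Matrix.toLin' (A.frame i)).isClosedEmbedding_of_injective
      (LinearMap.ker_eq_bot.2 this)).measurableEmbedding
  have h3 := he.integral_map (μ := volume) (fun s => F (A.z + WithLp.toLp 2 s))
  rw [h2, integral_smul_measure, ENNReal.toReal_ofReal (abs_nonneg _), smul_eq_mul] at h3
  rw [h1]
  simp only [param]
  simp only [Matrix.toLin'_apply] at h3
  rw [← h3, ← mul_assoc, abs_inv, mul_inv_cancel₀ (abs_ne_zero.2 hd), one_mul]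

/-- Points of the unit cube with `∑ s ≥ 1` are mapped outside the interior of `T`, where `F`
vanishes. The reference simplex may thus be replaced by the cube, on which the divergence theorem
for boxes is available. -/
theorem integral_cell (i : Fin 4) {F : Vec → ℝ} (hF : ∀ x, x ∉ interior A.T → F x = 0) :
    ∫ x in A.cell i, F x = |(A.frame i).det| * ∫ s in Set.Icc 0 1, F (A.param i s) := by
  rw [← integral_indicator (A.isClosed_cell i).measurableSet, A.integral_frame i,
    ← integral_indicator measurableSet_Icc]
  congr 2
  ext s
  by_cases hs : A.param i s ∈ interior A.T
  · have h1 := A.sum_lt_one_of_param_mem hs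
    by_cases h0 : ∀ m, 0 ≤ s m
    · rw [Set.indicator_of_mem ((A.param_mem_cell_iff i s).2 ⟨h0, h1.le⟩), Set.indicator_of_mem]
      refine ⟨h0, fun m => (Finset.single_le_sum (fun m _ => h0 m) (Finset.mem_univ m)).trans h1.le⟩
    · rw [Set.indicator_of_notMem (fun h => h0 ((A.param_mem_cell_iff i s).1 h).1),
        Set.indicator_of_notMem (fun h => h0 h.1)]
  · simp only [Set.indicator, hF _ hs, ite_self]

/-- The parametrization of the cone over the interior face of `T_i` opposite to its vertex
`i.succAbove m`. -/
def faceParam (i : Fin 4) (m : Fin 3) (s : Fin 2 → ℝ) : Vec := A.param i (m.insertNth 0 s)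

theorem faceParam_eq (i : Fin 4) (m : Fin 3) (s : Fin 2 → ℝ) :
    A.faceParam i m s =
      A.z + WithLp.toLp 2 (∑ l, s l • A.vtx (i.succAbove (m.succAbove l))) := by
  rw [faceParam, param, frame_mulVec, Fin.sum_univ_succAbove _ m]
  simp

/-! ### The divergence theorem on a cell -/

/-- The divergence of an affine vector field. -/
def vdiv (q : Vec →ᵃ[ℝ] (Fin 3 → ℝ)) : ℝ := ∑ c, q.linear (EuclideanSpace.single c 1) c

/-- Divergence theorem on the cube for the pulled-back field with components `φ * (coframe i m ⬝ᵥ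
q)`. Only the faces `s_m = 0`, the interior faces of the split, contribute; there `coframe i m`
points into the cell, hence the minus sign. -/
theorem integral_cell_divergence (i : Fin 4) (q : Vec →ᵃ[ℝ] (Fin 3 → ℝ)) {φ : Vec → ℝ}
    (hφ : ContDiff ℝ (⊤ : ℕ∞) φ) (ht : tsupport φ ⊆ interior A.T) :
    ∫ x in A.cell i, (∑ c, q x c * fderiv ℝ φ x (EuclideanSpace.single c 1) + vdiv q * φ x) =
      -∑ m, ∫ s in Set.Icc 0 1, φ (A.faceParam i m s) *
        (|(A.frame i).det| * (A.coframe i m ⬝ᵥ q (A.faceParam i m s))) := by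
  have h0 : ∀ x, x ∉ interior A.T → φ x = 0 := fun x hx =>
    image_eq_zero_of_notMem_tsupport fun h => hx (ht h)
  have h0' : ∀ x, x ∉ interior A.T → fderiv ℝ φ x = 0 := fun x hx =>
    image_eq_zero_of_notMem_tsupport fun h => hx (ht (tsupport_fderiv_subset ℝ h))
  rw [A.integral_cell i fun x hx => by simp [h0 x hx, h0' x hx]]
  set P : (Fin 3 → ℝ) →L[ℝ] Vec := ((WithLp.linearEquiv 2 ℝ (Fin 3 → ℝ)).symm.toLinearMap ∘ₗ
    Matrix.toLin' (A.frame i)).toContinuousLinearMap with hP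
  have hPa : ∀ s, P s = WithLp.toLp 2 (A.frame i *ᵥ s) := fun s => rfl
  have hparam : ∀ s, HasFDerivAt (A.param i) P s := fun s => (P.hasFDerivAt).const_add A.z
  set Q : Vec →L[ℝ] (Fin 3 → ℝ) := q.linear.toContinuousLinearMap with hQ
  have hqd : ∀ x, HasFDerivAt q Q x := fun x => by
    have : (q : Vec → Fin 3 → ℝ) = fun x => Q x + q 0 := by
      ext1 x
      exact congrFun q.decomp x
    rw [this]
    exact Q.hasFDerivAt.add_const _
  set D : Fin 3 → (Fin 3 → ℝ) →L[ℝ] ℝ := fun m =>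
    (dotProductBilin ℝ ℝ (A.coframe i m)).toContinuousLinearMap with hD
  have hDa : ∀ m v, D m v = A.coframe i m ⬝ᵥ v := fun m v => rfl
  have hφd : ∀ x, HasFDerivAt φ (fderiv ℝ φ x) x := fun x =>
    ((hφ.differentiable (by simp)) x).hasFDerivAt
  have key := integral_divergence_of_hasFDerivAt_off_countable' (n := 2) (E := ℝ) 0 1
    (by intro m; simp)
    (fun m s => φ (A.param i s) * D m (q (A.param i s)))
    (fun m s => φ (A.param i s) • ((D m).comp (Q.comp P)) +
      D m (q (A.param i s)) • ((fderiv ℝ φ (A.param i s)).comp P))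
    ∅ Set.countable_empty ?_ ?_ ?_
  · have e1 : ∀ s, (∑ m, (φ (A.param i s) • ((D m).comp (Q.comp P)) +
      D m (q (A.param i s)) • ((fderiv ℝ φ (A.param i s)).comp P)) (Pi.single m 1)) =
        ∑ c, q (A.param i s) c * fderiv ℝ φ (A.param i s) (EuclideanSpace.single c 1) +
          vdiv q * φ (A.param i s) := by
      intro s
      set x := A.param i s
      have hPs : ∀ m, P (Pi.single m 1) = WithLp.toLp 2 (A.vtx (i.succAbove m)) := fun m => by
        rw [hPa, frame_mulVec]
        congr 1
        rw [Finset.sum_eq_single m (fun b _ hb => by rw [Pi.single_eq_of_ne hb, zero_smul])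
          (by simp)]
        simp
      -- `f1` and `f2` express that the pairing of a vector with a covector and the trace of a
      -- linear map do not depend on the basis: the dual bases `vtx`, `coframe` replace the standard
      -- one.
      have f1 : ∑ m, D m (q x) * fderiv ℝ φ x (WithLp.toLp 2 (A.vtx (i.succAbove m))) =
          ∑ c, q x c * fderiv ℝ φ x (EuclideanSpace.single c 1) := by
        have a1 : ∑ m, D m (q x) • WithLp.toLp 2 (A.vtx (i.succAbove m)) = WithLp.toLp 2 (q x) := by
          have := congrArg (WithLp.toLp 2) (A.sum_coframe_smul i (q x))
          simpa only [hDa, WithLp.toLp_sum, WithLp.toLp_smul] using this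
        have a2 : ∑ c, q x c • EuclideanSpace.single c (1 : ℝ) = WithLp.toLp 2 (q x) := by
          ext j
          simp [Pi.single_apply]
        have := congrArg (fderiv ℝ φ x) (a1.trans a2.symm)
        simpa only [map_sum, map_smul, smul_eq_mul] using this
      have f2 : ∑ m, D m (Q (WithLp.toLp 2 (A.vtx (i.succAbove m)))) = vdiv q := by
        have a : ∀ c, EuclideanSpace.single c (1 : ℝ) =
            ∑ m, A.coframe i m c • WithLp.toLp 2 (A.vtx (i.succAbove m)) := fun c => by
          have := congrArg (WithLp.toLp 2) (A.sum_coframe_smul i (Pi.single c 1))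
          simp only [WithLp.toLp_sum, WithLp.toLp_smul, dotProduct_single, mul_one] at this
          rw [this]
          rfl
        simp only [vdiv, a, map_sum, map_smul, Finset.sum_apply, Pi.smul_apply, smul_eq_mul]
        rw [Finset.sum_comm]
        rfl
      simp only [_root_.add_apply, _root_.smul_apply,
        ContinuousLinearMap.comp_apply, hPs, smul_eq_mul, Finset.sum_add_distrib, f1,
        ← Finset.mul_sum, f2]
      ring
    rw [setIntegral_congr_fun measurableSet_Icc (fun s _ => e1 s)] at key
    rw [key, Finset.mul_sum, ← Finset.sum_neg_distrib]
    refine Finset.sum_congr rfl fun m _ => ?_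
    -- On the opposite face `s_m = 1` the coordinate sum is at least one, outside the support of
    -- `φ`.
    have z1 : ∀ s ∈ Set.Icc ((0 : Fin 3 → ℝ) ∘ m.succAbove) ((1 : Fin 3 → ℝ) ∘ m.succAbove),
        φ (A.param i (m.insertNth ((1 : Fin 3 → ℝ) m) s)) *
          D m (q (A.param i (m.insertNth ((1 : Fin 3 → ℝ) m) s))) = 0 := by
      intro s hs
      rw [h0, zero_mul]
      intro hmem
      have := A.sum_lt_one_of_param_mem hmem
      rw [Fin.sum_univ_succAbove _ m] at this
      simp only [Fin.insertNth_apply_same, Fin.insertNth_apply_succAbove, Pi.one_apply] at this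
      have h2 : 0 ≤ ∑ l, s l := Finset.sum_nonneg fun l _ => hs.1 l
      linarith
    rw [setIntegral_congr_fun measurableSet_Icc z1]
    simp only [integral_zero, zero_sub, mul_neg, neg_inj]
    rw [← integral_const_mul]
    refine integral_congr_ae (Filter.Eventually.of_forall fun s => ?_)
    simp only [hDa, faceParam]
    change _ * (φ (A.param i (m.insertNth 0 s)) * _) = _
    ring_nf
    rfl
  · intro m
    refine Continuous.continuousOn ?_
    exact (hφ.continuous.comp (A.continuous_param i)).mul ((D m).continuous.comp
      (q.continuous_of_finiteDimensional.comp (A.continuous_param i)))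
  · intro s _ m
    exact ((hφd _).comp s (hparam s)).mul ((D m).hasFDerivAt.comp s ((hqd _).comp s (hparam s)))
  · refine ContinuousOn.integrableOn_compact isCompact_Icc (Continuous.continuousOn ?_)
    have c1 : Continuous fun s => φ (A.param i s) := hφ.continuous.comp (A.continuous_param i)
    have c2 : Continuous fun s => fderiv ℝ φ (A.param i s) :=
      (hφ.continuous_fderiv (by simp)).comp (A.continuous_param i)
    have c3 : Continuous fun s => q (A.param i s) :=
      q.continuous_of_finiteDimensional.comp (A.continuous_param i)
    simp only [_root_.add_apply, _root_.smul_apply,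
      ContinuousLinearMap.comp_apply]
    exact continuous_finsetSum _ fun m _ => (c1.smul continuous_const).add
      (((D m).continuous.comp c3).smul (c2.clm_apply continuous_const))

/-! ### Distributional divergence and jumps across the interior faces -/

/-- A row of an affine matrix field. -/
def rowPiece (p : Vec →ᵃ[ℝ] Mat) (r : Fin 3) : Vec →ᵃ[ℝ] (Fin 3 → ℝ) :=
  ({ toFun := fun M => M r, map_add' := fun _ _ => rfl, map_smul' := fun _ _ => rfl } :
    Mat →ₗ[ℝ] (Fin 3 → ℝ)).toAffineMap.comp p

@[simp] theorem rowPiece_apply (p : Vec →ᵃ[ℝ] Mat) (r : Fin 3) (x : Vec) :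
    rowPiece p r x = p x r := rfl

/-- The row-wise divergence of an affine matrix field. -/
def matDiv (p : Vec →ᵃ[ℝ] Mat) : Fin 3 → ℝ := fun r => vdiv (rowPiece p r)

/-- Continuity of the normal components across the interior faces. -/
def NormalContinuous (p : Fin 4 → Vec →ᵃ[ℝ] Mat) : Prop :=
  ∀ i k x, A.gam i x = A.gam k x → (p i x - p k x) *ᵥ (A.grad i - A.grad k) = 0

/-- The involution that views an interior face from the other cell that contains it. -/
def flip (x : Fin 4 × Fin 3) : Fin 4 × Fin 3 := (x.1.succAbove x.2, x.2.predAbove x.1)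

theorem flip_flip (x : Fin 4 × Fin 3) : flip (flip x) = x := by
  revert x; decide

theorem flip_ne (x : Fin 4 × Fin 3) : flip x ≠ x := by
  revert x; decide

/-- An interior face corresponds to an unordered pair of cells. A different pair contains an index
outside the given one, which later separates the support of a bump function from all other faces. -/
theorem face_ne {x y : Fin 4 × Fin 3} (h : y ≠ x) (h' : y ≠ flip x) :
    (y.1 ≠ x.1 ∧ y.1 ≠ x.1.succAbove x.2) ∨
      (y.1.succAbove y.2 ≠ x.1 ∧ y.1.succAbove y.2 ≠ x.1.succAbove x.2) := by
  revert x y; decide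

/-- Both views list the two remaining vertices in increasing order, so even the parametrizations
agree and the face integrals can be added pointwise. -/
theorem faceParam_flip (x : Fin 4 × Fin 3) :
    A.faceParam (flip x).1 (flip x).2 = A.faceParam x.1 x.2 := by
  ext1 s
  simp only [faceParam_eq, flip, Fin.succAbove_succAbove_succAbove_predAbove]

theorem gam_faceParam (i : Fin 4) (m : Fin 3) (s : Fin 2 → ℝ) :
    A.gam i (A.faceParam i m s) = -∑ l, s l := by
  rw [faceParam, gam_param, Fin.sum_univ_succAbove _ m]
  simp

theorem gam_faceParam_succAbove (i : Fin 4) (m : Fin 3) (s : Fin 2 → ℝ) :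
    A.gam (i.succAbove m) (A.faceParam i m s) = -∑ l, s l := by
  rw [faceParam, gam_param_succAbove, Fin.sum_univ_succAbove _ m]
  simp

theorem gam_faceParam_succAbove_succAbove (i : Fin 4) (m : Fin 3) (s : Fin 2 → ℝ) (l : Fin 2) :
    A.gam (i.succAbove (m.succAbove l)) (A.faceParam i m s) =
      (A.weight (i.succAbove (m.succAbove l)))⁻¹ * s l - ∑ l, s l := by
  rw [faceParam, gam_param_succAbove, Fin.sum_univ_succAbove _ m]
  simp

/-- On an interior face the minimum of the `gam j` is attained by both adjacent cells. -/
theorem neg_sum_le_gam_faceParam (i : Fin 4) (m : Fin 3) {s : Fin 2 → ℝ} (hs : ∀ l, 0 ≤ s l)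
    (j : Fin 4) : -∑ l, s l ≤ A.gam j (A.faceParam i m s) := by
  rcases eq_or_ne j i with rfl | hj
  · rw [gam_faceParam]
  · obtain ⟨n, rfl⟩ := Fin.exists_succAbove_eq hj
    rcases eq_or_ne n m with rfl | hn
    · rw [gam_faceParam_succAbove]
    · obtain ⟨l, rfl⟩ := Fin.exists_succAbove_eq hn
      rw [gam_faceParam_succAbove_succAbove]
      have := mul_nonneg (inv_pos.2 (A.weight_pos (i.succAbove (m.succAbove l)))).le (hs l)
      linarith

theorem faceParam_notMem_interior_cell (i : Fin 4) (m : Fin 3) {s : Fin 2 → ℝ}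
    (hs : ∀ l, 0 ≤ s l) (j : Fin 4) : A.faceParam i m s ∉ interior (A.cell j) := by
  intro h
  have h1 := (A.mem_interior_cell_iff.1 h).2
  have h2 := A.neg_sum_le_gam_faceParam i m hs j
  rcases eq_or_ne i j with rfl | hij
  · have := h1 _ (Fin.succAbove_ne i m)
    rw [gam_faceParam_succAbove] at this
    linarith
  · have := h1 i hij
    rw [gam_faceParam] at this
    linarith

theorem continuous_faceParam (i : Fin 4) (m : Fin 3) : Continuous (A.faceParam i m) := by
  have : A.faceParam i m = fun s => A.z +
      WithLp.toLp 2 (∑ l, s l • A.vtx (i.succAbove (m.succAbove l))) := by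
    ext1 s; exact A.faceParam_eq i m s
  rw [this]
  fun_prop

/-- The boundary term of an interior face. -/
def faceTerm (φ : Vec → ℝ) (q : Fin 4 → Vec →ᵃ[ℝ] (Fin 3 → ℝ)) (x : Fin 4 × Fin 3) : ℝ :=
  ∫ s in Set.Icc 0 1, φ (A.faceParam x.1 x.2 s) *
    (|(A.frame x.1).det| * (A.coframe x.1 x.2 ⬝ᵥ q x.1 (A.faceParam x.1 x.2 s)))

theorem faceTerm_add_flip {φ : Vec → ℝ} (hφ : Continuous φ)
    (q : Fin 4 → Vec →ᵃ[ℝ] (Fin 3 → ℝ)) (x : Fin 4 × Fin 3) :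
    A.faceTerm φ q x + A.faceTerm φ q (flip x) =
      (A.faceFactor * A.weight x.1 * A.weight (x.1.succAbove x.2)) *
        ∫ s in Set.Icc 0 1, φ (A.faceParam x.1 x.2 s) *
          ((q x.1 (A.faceParam x.1 x.2 s) - q (x.1.succAbove x.2) (A.faceParam x.1 x.2 s)) ⬝ᵥ
            (A.grad (x.1.succAbove x.2) - A.grad x.1)) := by
  have hint : ∀ y : Fin 4 × Fin 3, IntegrableOn (fun s => φ (A.faceParam y.1 y.2 s) *
    (|(A.frame y.1).det| * (A.coframe y.1 y.2 ⬝ᵥ q y.1 (A.faceParam y.1 y.2 s))))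
      (Set.Icc 0 1) := by
    intro y
    refine ContinuousOn.integrableOn_compact isCompact_Icc (Continuous.continuousOn ?_)
    have c1 := A.continuous_faceParam y.1 y.2
    have c2 := ((q y.1).continuous_of_finiteDimensional).comp c1
    exact (hφ.comp c1).mul (continuous_const.mul (continuous_const.dotProduct c2))
  rw [faceTerm, faceTerm, ← integral_add (hint x) (hint (flip x)), ← integral_const_mul]
  refine integral_congr_ae (Filter.Eventually.of_forall fun s => ?_)
  simp only [faceParam_flip]
  have e1 : (flip x).1 = x.1.succAbove x.2 := rfl
  have e2 : (flip x).1.succAbove (flip x).2 = x.1 := Fin.succAbove_succAbove_predAbove _ _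
  simp only [coframe, e2, abs_det_frame]
  simp only [e1, smul_dotProduct, sub_dotProduct, dotProduct_sub, smul_eq_mul,
    dotProduct_comm (q _ _)]
  ring

theorem integral_divergence {ω : A.L2Mat} {p : Fin 4 → Vec →ᵃ[ℝ] Mat}
    (hp : ∀ i, A.IsPiece ω i (p i)) {φ : Vec → ℝ} (hφ : ContDiff ℝ (⊤ : ℕ∞) φ)
    (hs : HasCompactSupport φ) (ht : tsupport φ ⊆ interior A.T) (r : Fin 3) :
    ∫ x, ∑ c, ω r c x * fderiv ℝ φ x (EuclideanSpace.single c 1) ∂A.vol =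
      -(∑ i, ∫ x in A.cell i, matDiv (p i) r * φ x) -
        ∑ x, A.faceTerm φ (fun i => rowPiece (p i) r) x := by
  rw [A.integral_vol (A.integrable_div_left ω hφ hs r), Fintype.sum_prod_type, ← neg_add',
    ← Finset.sum_add_distrib, ← Finset.sum_neg_distrib]
  refine Finset.sum_congr rfl fun i _ => ?_
  have h := A.integral_cell_divergence i (rowPiece (p i) r) hφ ht
  have hc : Continuous fun x => ∑ c, rowPiece (p i) r x c *
      fderiv ℝ φ x (EuclideanSpace.single c 1) := by
    refine continuous_finsetSum _ fun c _ => Continuous.mul ?_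
      ((hφ.continuous_fderiv (by simp)).clm_apply continuous_const)
    exact (continuous_apply c).comp (rowPiece (p i) r).continuous_of_finiteDimensional
  have hk : IsCompact (A.cell i) := (Set.finite_range _).isCompact_convexHull ℝ
  have hc' : Continuous fun x => vdiv (rowPiece (p i) r) * φ x :=
    continuous_const.mul hφ.continuous
  rw [integral_add (hc.continuousOn.integrableOn_compact hk)
    (hc'.continuousOn.integrableOn_compact hk)] at h
  have e : ∫ x in A.cell i, ∑ c, ω r c x * fderiv ℝ φ x (EuclideanSpace.single c 1) =
      ∫ x in A.cell i, ∑ c, rowPiece (p i) r x c * fderiv ℝ φ x (EuclideanSpace.single c 1) := by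
    refine integral_congr_ae ?_
    filter_upwards [ae_all_iff.2 fun c => hp i r c] with x hx
    exact Finset.sum_congr rfl fun c _ => by rw [hx c]; rfl
  rw [e, neg_add, ← sub_eq_add_neg, eq_sub_iff_add_eq]
  simp only [faceTerm, matDiv]
  linarith

/-- Cellwise integration by parts separates the defining identity into a volume defect and face
terms. Choosing where `φ` is supported isolates either one. -/
theorem isDiv_iff {ω : A.L2Mat} {p : Fin 4 → Vec →ᵃ[ℝ] Mat} (hp : ∀ i, A.IsPiece ω i (p i))
    (d : A.L2Vec) : A.IsDiv ω d ↔ ∀ φ : Vec → ℝ, ContDiff ℝ (⊤ : ℕ∞) φ → HasCompactSupport φ →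
      tsupport φ ⊆ interior A.T → ∀ r : Fin 3,
        ∑ i, ∫ x in A.cell i, φ x • (d x r - matDiv (p i) r) =
          ∑ x, A.faceTerm φ (fun i => rowPiece (p i) r) x := by
  refine forall₅_congr fun φ hφ hs ht r => ?_
  rw [A.integral_divergence hp hφ hs ht r]
  have hd := A.integrable_mul_test (A.integrable_coord d r) hφ.continuous hs
  rw [A.integral_vol hd]
  have hk : ∀ i, IsCompact (A.cell i) := fun i => (Set.finite_range _).isCompact_convexHull ℝ
  have e : ∑ i, ∫ x in A.cell i, φ x • (d x r - matDiv (p i) r) =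
      ∑ i, (∫ x in A.cell i, d x r * φ x) - ∑ i, (∫ x in A.cell i, matDiv (p i) r * φ x) := by
    rw [← Finset.sum_sub_distrib]
    refine Finset.sum_congr rfl fun i _ => ?_
    have hc : Continuous fun x => matDiv (p i) r * φ x := continuous_const.mul hφ.continuous
    rw [← integral_sub (A.integrable_cell hd i) (hc.continuousOn.integrableOn_compact (hk i))]
    refine integral_congr_ae (Filter.Eventually.of_forall fun x => ?_)
    simp only [smul_eq_mul]
    ring
  rw [e]
  constructor <;> intro h <;> linarith

theorem isDiv_of_normalContinuous {ω : A.L2Mat} {p : Fin 4 → Vec →ᵃ[ℝ] Mat}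
    (hp : ∀ i, A.IsPiece ω i (p i)) (hc : A.NormalContinuous p) {d : A.L2Vec}
    (hd : ∀ i, ∀ᵐ x ∂volume.restrict (A.cell i), (d x).ofLp = matDiv (p i)) : A.IsDiv ω d := by
  rw [A.isDiv_iff hp]
  intro φ hφ hs ht r
  have hz : ∀ i ∈ Finset.univ, ∫ x in A.cell i, φ x • (d x r - matDiv (p i) r) = 0 := by
    intro i _
    refine integral_eq_zero_of_ae ?_
    filter_upwards [hd i] with x hx
    rw [hx]
    simp
  rw [Finset.sum_eq_zero hz, eq_comm]
  -- Each interior face occurs twice, and the two contributions add up to the integral of a normal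
  -- jump, which is zero.
  refine Finset.sum_involution (fun x _ => flip x) ?_ (fun x _ _ => flip_ne x)
    (fun x _ => Finset.mem_univ _) fun x _ => flip_flip x
  intro x _
  rw [A.faceTerm_add_flip hφ.continuous, integral_eq_zero_of_ae, mul_zero]
  refine Filter.Eventually.of_forall fun s => ?_
  have h := congrFun (hc x.1 (x.1.succAbove x.2) (A.faceParam x.1 x.2 s)
    (by rw [gam_faceParam, gam_faceParam_succAbove])) r
  have h2 : (p x.1 (A.faceParam x.1 x.2 s) r -
      p (x.1.succAbove x.2) (A.faceParam x.1 x.2 s) r) ⬝ᵥ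
        (A.grad x.1 - A.grad (x.1.succAbove x.2)) = 0 := h
  simp only [rowPiece_apply]
  rw [← neg_sub (A.grad x.1), dotProduct_neg, h2]
  simp

/-- Test functions supported inside one open cell meet no interior face, so the face terms drop out
and the fundamental lemma of the calculus of variations applies. -/
theorem ae_eq_matDiv_of_isDiv {ω : A.L2Mat} {p : Fin 4 → Vec →ᵃ[ℝ] Mat}
    (hp : ∀ i, A.IsPiece ω i (p i)) {d : A.L2Vec} (h : A.IsDiv ω d) (i : Fin 4) :
    ∀ᵐ x ∂volume.restrict (A.cell i), (d x).ofLp = matDiv (p i) := by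
  rw [A.isDiv_iff hp] at h
  suffices H : ∀ r, ∀ᵐ x, x ∈ interior (A.cell i) → d x r - matDiv (p i) r = 0 by
    have H2 := ae_restrict_of_ae (s := A.cell i) (ae_all_iff.2 H)
    filter_upwards [H2, A.ae_mem_interior_cell i] with x hx hxi
    ext r
    exact sub_eq_zero.1 (hx r hxi)
  intro r
  have hint : IntegrableOn (fun x => d x r - matDiv (p i) r) (A.cell i) :=
    (A.integrable_cell (A.integrable_coord d r) i).sub
      (integrableOn_const ((Set.finite_range _).isCompact_convexHull ℝ).measure_lt_top.ne)
  refine isOpen_interior.ae_eq_zero_of_integral_contDiff_smul_eq_zero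
    (hint.mono_set interior_subset).locallyIntegrableOn fun φ hφ hs ht => ?_
  have h0 : ∀ x, x ∉ interior (A.cell i) → φ x = 0 := fun x hx =>
    image_eq_zero_of_notMem_tsupport fun h => hx (ht h)
  have h1 := h φ hφ hs (ht.trans (interior_mono (A.cell_subset i))) r
  rw [Finset.sum_eq_single i, Finset.sum_eq_zero] at h1
  · rw [← h1]
    refine (setIntegral_eq_integral_of_forall_compl_eq_zero fun x hx => ?_).symm
    rw [h0 x fun h => hx (interior_subset h), zero_smul]
  · intro x _
    refine setIntegral_eq_zero_of_forall_eq_zero fun s hs => ?_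
    rw [h0 _ (A.faceParam_notMem_interior_cell x.1 x.2 (fun l => hs.1 l) i), zero_mul]
  · intro j _ hj
    refine integral_eq_zero_of_ae ?_
    filter_upwards [A.ae_mem_interior_cell j] with x hx
    rw [h0 x (Set.disjoint_left.1 (A.interior_cell_disjoint hj) hx), zero_smul]
    rfl
  · simp

/-- If the jump `J` were nonzero at a point of the open face, a bump function near that point would
see no other face and a jump of constant sign. Since the volume terms already vanish, the face
integral would have to be zero, although its integrand is nonnegative after multiplication by `J x₀`
and positive somewhere. -/
theorem faceParam_interior_jump {ω : A.L2Mat} {p : Fin 4 → Vec →ᵃ[ℝ] Mat}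
    (hp : ∀ i, A.IsPiece ω i (p i)) {d : A.L2Vec} (h : A.IsDiv ω d) (y : Fin 4 × Fin 3)
    {s₀ : Fin 2 → ℝ} (hs0 : ∀ l, 0 < s₀ l) (hs1 : ∑ l, s₀ l < 1) (r : Fin 3) :
    (p y.1 (A.faceParam y.1 y.2 s₀) r - p (y.1.succAbove y.2) (A.faceParam y.1 y.2 s₀) r) ⬝ᵥ
      (A.grad (y.1.succAbove y.2) - A.grad y.1) = 0 := by
  set k := y.1.succAbove y.2 with hk
  set x₀ := A.faceParam y.1 y.2 s₀ with hx0
  set J : Vec → ℝ := fun x => (rowPiece (p y.1) r x - rowPiece (p k) r x) ⬝ᵥ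
    (A.grad k - A.grad y.1) with hJ
  change J x₀ = 0
  by_contra hne
  have hJc : Continuous J := ((rowPiece (p y.1) r).continuous_of_finiteDimensional.sub
    (rowPiece (p k) r).continuous_of_finiteDimensional).dotProduct continuous_const
  -- The second set fixes the sign of `J`. The third excludes the other faces: on each of them some
  -- `gam j` with `j` outside the pair is minimal.
  set N : Set Vec := interior A.T ∩ {x | 0 < J x₀ * J x} ∩
    {x | ∀ j, j ≠ y.1 → j ≠ k → A.gam y.1 x < A.gam j x ∧ A.gam k x < A.gam j x} with hN
  have hNo : IsOpen N := by
    refine (isOpen_interior.inter (isOpen_lt continuous_const (continuous_const.mul hJc))).inter ?_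
    simp only [Set.ofPred_forall]
    refine isOpen_iInter_of_finite fun j => isOpen_iInter_of_finite fun _ =>
      isOpen_iInter_of_finite fun _ => ?_
    exact (isOpen_lt (A.continuous_gam _) (A.continuous_gam _)).inter
      (isOpen_lt (A.continuous_gam _) (A.continuous_gam _))
  have hxN : x₀ ∈ N := by
    refine ⟨⟨A.mem_interior_T_iff.2 fun j => ?_, mul_self_pos.2 hne⟩, fun j h1 h2 => ?_⟩
    · have := A.neg_sum_le_gam_faceParam y.1 y.2 (fun l => (hs0 l).le) j
      linarith
    · obtain ⟨n, rfl⟩ := Fin.exists_succAbove_eq h1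
      obtain ⟨l, rfl⟩ := Fin.exists_succAbove_eq (fun hn => h2 (congrArg _ hn))
      rw [hx0, hk, gam_faceParam, gam_faceParam_succAbove, gam_faceParam_succAbove_succAbove]
      have := mul_pos (inv_pos.2 (A.weight_pos (y.1.succAbove (y.2.succAbove l)))) (hs0 l)
      constructor <;> linarith
  obtain ⟨ε, hε, hball⟩ := Metric.nhds_basis_closedBall.mem_iff.1 (hNo.mem_nhds hxN)
  let f : ContDiffBump x₀ := ⟨ε / 2, ε, half_pos hε, half_lt_self hε⟩
  have ht : tsupport f ⊆ N := by rw [f.tsupport_eq]; exact hball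
  have h0 : ∀ x, x ∉ N → f x = 0 := fun x hx =>
    image_eq_zero_of_notMem_tsupport fun h => hx (ht h)
  have hdiv := A.ae_eq_matDiv_of_isDiv hp h
  rw [A.isDiv_iff hp] at h
  have h1 := h f f.contDiff f.hasCompactSupport (ht.trans fun x hx => hx.1.1) r
  rw [Finset.sum_eq_zero, Finset.sum_eq_add_of_mem y (flip y) (Finset.mem_univ _)
    (Finset.mem_univ _) (flip_ne y).symm, A.faceTerm_add_flip f.continuous, eq_comm,
    mul_eq_zero] at h1
  · have hw := mul_pos (mul_pos A.faceFactor_pos (A.weight_pos y.1))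
      (A.weight_pos (y.1.succAbove y.2))
    have h2 := h1.resolve_left hw.ne'
    have h3 : ∫ s in Set.Icc 0 1, f (A.faceParam y.1 y.2 s) *
        (J x₀ * J (A.faceParam y.1 y.2 s)) = 0 := by
      have : ∀ s, f (A.faceParam y.1 y.2 s) * (J x₀ * J (A.faceParam y.1 y.2 s)) =
        J x₀ * (f (A.faceParam y.1 y.2 s) * J (A.faceParam y.1 y.2 s)) := fun s => by ring
      simp only [this]
      rw [integral_const_mul]
      exact mul_eq_zero_of_right _ h2
    have hc : Continuous fun s => f (A.faceParam y.1 y.2 s) *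
        (J x₀ * J (A.faceParam y.1 y.2 s)) :=
      (f.continuous.comp (A.continuous_faceParam _ _)).mul
        (continuous_const.mul (hJc.comp (A.continuous_faceParam _ _)))
    have hnn : ∀ s, 0 ≤ f (A.faceParam y.1 y.2 s) * (J x₀ * J (A.faceParam y.1 y.2 s)) := by
      intro s
      by_cases hsN : A.faceParam y.1 y.2 s ∈ N
      · exact mul_nonneg f.nonneg hsN.1.2.le
      · rw [h0 _ hsN, zero_mul]
    have hpos : 0 < ∫ s in Set.Icc 0 1, f (A.faceParam y.1 y.2 s) *
        (J x₀ * J (A.faceParam y.1 y.2 s)) := by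
      rw [setIntegral_pos_iff_support_of_nonneg_ae (Filter.Eventually.of_forall hnn)
        (hc.continuousOn.integrableOn_compact isCompact_Icc)]
      set O : Set (Fin 2 → ℝ) := Set.univ.pi fun _ => Set.Ioo (0 : ℝ) 1
      have hO : IsOpen O := isOpen_set_pi Set.finite_univ fun _ _ => isOpen_Ioo
      refine lt_of_lt_of_le ((hc.isOpen_support.inter hO).measure_pos volume ⟨s₀, ?_, ?_⟩)
        (measure_mono (Set.inter_subset_inter_right _ fun s hs =>
          ⟨fun l => (hs l trivial).1.le, fun l => (hs l trivial).2.le⟩))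
      · rw [Function.mem_support, ← hx0,
          f.one_of_mem_closedBall (Metric.mem_closedBall_self f.rIn_pos.le), one_mul]
        exact (mul_self_pos.2 hne).ne'
      · exact fun l _ => ⟨hs0 l,
          (Finset.single_le_sum (fun l _ => (hs0 l).le) (Finset.mem_univ l)).trans_lt hs1⟩
    exact hpos.ne' h3
  · intro x _ hx
    refine setIntegral_eq_zero_of_forall_eq_zero fun s hs => ?_
    rw [h0, zero_mul]
    intro hxN
    have hs' : ∀ l, 0 ≤ s l := fun l => hs.1 l
    have hl := A.neg_sum_le_gam_faceParam x.1 x.2 hs' y.1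
    rcases face_ne hx.1 hx.2 with h1 | h1
    · have := (hxN.2 _ h1.1 h1.2).1
      rw [gam_faceParam] at this
      linarith
    · have := (hxN.2 _ h1.1 h1.2).1
      rw [gam_faceParam_succAbove] at this
      linarith
  · intro i _
    refine integral_eq_zero_of_ae ?_
    filter_upwards [hdiv i] with x hx
    rw [hx]
    simp

/-- Passage from the open to the closed triangle: the midpoint of `v` and the interior point `(1/3,
1/3)` is interior, so `f` vanishes there and at the interior point, hence at `v`. This reaches the
nodes themselves. -/
theorem affine_midpoint_zero {f : (Fin 2 → ℝ) → ℝ} {v : Fin 2 → ℝ}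
    (hf : ∀ a b, f ((2⁻¹ : ℝ) • a + (2⁻¹ : ℝ) • b) = 2⁻¹ * f a + 2⁻¹ * f b)
    (h0 : ∀ s : Fin 2 → ℝ, (∀ l, 0 < s l) → ∑ l, s l < 1 → f s = 0)
    (hv : ∀ l, 0 ≤ v l) (hv1 : ∑ l, v l ≤ 1) : f v = 0 := by
  have h1 : f (fun _ => 3⁻¹) = 0 := h0 _ (fun _ => by norm_num) (by norm_num)
  have h2 : f ((2⁻¹ : ℝ) • v + (2⁻¹ : ℝ) • fun _ => 3⁻¹) = 0 := by
    refine h0 _ (fun l => ?_) ?_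
    · simp only [Pi.add_apply, Pi.smul_apply, smul_eq_mul]
      have := hv l
      positivity
    · rw [Fin.sum_univ_two] at hv1 ⊢
      simp only [Pi.add_apply, Pi.smul_apply, smul_eq_mul]
      linarith
  rw [hf, h1] at h2
  linarith

/-- The normal components are continuous at all points of the closed interior faces. -/
theorem faceParam_jump {ω : A.L2Mat} {p : Fin 4 → Vec →ᵃ[ℝ] Mat}
    (hp : ∀ i, A.IsPiece ω i (p i)) {d : A.L2Vec} (h : A.IsDiv ω d) (y : Fin 4 × Fin 3)
    {s : Fin 2 → ℝ} (hs0 : ∀ l, 0 ≤ s l) (hs1 : ∑ l, s l ≤ 1) :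
    (p y.1 (A.faceParam y.1 y.2 s) - p (y.1.succAbove y.2) (A.faceParam y.1 y.2 s)) *ᵥ
      (A.grad y.1 - A.grad (y.1.succAbove y.2)) = 0 := by
  ext r
  have key := affine_midpoint_zero (v := s)
    (f := fun s => (rowPiece (p y.1) r (A.faceParam y.1 y.2 s) -
      rowPiece (p (y.1.succAbove y.2)) r (A.faceParam y.1 y.2 s)) ⬝ᵥ
      (A.grad (y.1.succAbove y.2) - A.grad y.1)) ?_
    (fun s h1 h2 => A.faceParam_interior_jump hp h y h1 h2 r) hs0 hs1
  · rw [← neg_sub (A.grad (y.1.succAbove y.2)), mulVec_neg, Pi.neg_apply, Pi.zero_apply,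
      neg_eq_zero]
    exact key
  · intro a b
    have e : A.faceParam y.1 y.2 ((2⁻¹ : ℝ) • a + (2⁻¹ : ℝ) • b) =
        AffineMap.lineMap (A.faceParam y.1 y.2 b) (A.faceParam y.1 y.2 a) (2⁻¹ : ℝ) := by
      rw [AffineMap.lineMap_apply_module]
      simp only [faceParam_eq, Pi.add_apply, Pi.smul_apply, add_smul, Finset.sum_add_distrib,
        smul_eq_mul, mul_smul, ← Finset.smul_sum, WithLp.toLp_add, WithLp.toLp_smul]
      module
    simp only [e, AffineMap.apply_lineMap]
    simp only [AffineMap.lineMap_apply_module, sub_dotProduct, add_dotProduct, smul_dotProduct,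
      smul_eq_mul]
    ring

theorem split_jump {ω : A.L2Mat} {p : Fin 4 → Vec →ᵃ[ℝ] Mat}
    (hp : ∀ i, A.IsPiece ω i (p i)) {d : A.L2Vec} (h : A.IsDiv ω d) (i k : Fin 4) :
    (p i A.z - p k A.z) *ᵥ (A.grad i - A.grad k) = 0 := by
  rcases eq_or_ne k i with rfl | hki
  · simp
  · obtain ⟨m, rfl⟩ := Fin.exists_succAbove_eq hki
    have := A.faceParam_jump hp h (i, m) (s := 0) (fun _ => le_rfl) (by simp)
    simpa [faceParam_eq] using this

theorem vertex_jump {ω : A.L2Mat} {p : Fin 4 → Vec →ᵃ[ℝ] Mat}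
    (hp : ∀ i, A.IsPiece ω i (p i)) {d : A.L2Vec} (h : A.IsDiv ω d) {i k j : Fin 4}
    (hi : j ≠ i) (hk : j ≠ k) :
    (p i (A.simplex.points j) - p k (A.simplex.points j)) *ᵥ (A.grad i - A.grad k) = 0 := by
  rcases eq_or_ne k i with rfl | hki
  · simp
  · obtain ⟨m, rfl⟩ := Fin.exists_succAbove_eq hki
    obtain ⟨n, rfl⟩ := Fin.exists_succAbove_eq hi
    obtain ⟨l, rfl⟩ := Fin.exists_succAbove_eq (fun hn => hk (congrArg _ hn))
    have := A.faceParam_jump hp h (i, m) (s := Pi.single l 1)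
      (fun l' => by by_cases h : l' = l <;> simp [h]) (by simp)
    have e : A.faceParam i m (Pi.single l 1) =
        A.simplex.points (i.succAbove (m.succAbove l)) := by
      rw [faceParam_eq, Finset.sum_eq_single l
        (fun b _ hb => by rw [Pi.single_eq_of_ne hb, zero_smul]) (by simp), Pi.single_eq_same,
        one_smul]
      exact add_sub_cancel _ _
    rwa [e] at this

/-! ### Affine fields reconstructed from nodal values -/

/-- The affine matrix field on the cell `T_i` with given values at the vertices of the cell. -/
def nodalField (i : Fin 4) (E : Fin 4 → Mat) : Vec →ᵃ[ℝ] Mat :=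
  (Fintype.linearCombination ℝ E).toAffineMap.comp (AffineMap.pi fun j => (A.cellBasis i).coord j)

theorem nodalField_apply (i : Fin 4) (E : Fin 4 → Mat) (x : Vec) :
    A.nodalField i E x = ∑ j, A.cellCoord i j x • E j := by
  simp [nodalField, Fintype.linearCombination_apply, cellBasis_coord]

theorem apply_eq_sum_cellCoord {F : Type*} [AddCommGroup F] [Module ℝ F] (p : Vec →ᵃ[ℝ] F)
    (i : Fin 4) (x : Vec) : p x = ∑ j, A.cellCoord i j x • p (A.cellBasis i j) := by
  have h := Finset.univ.map_affineCombination (A.cellBasis i) (fun j => A.cellCoord i j x)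
    (A.sum_cellCoord i x) p
  rw [Finset.affineCombination_eq_linear_combination _ _ _ (A.sum_cellCoord i x),
    Finset.affineCombination_eq_linear_combination _ _ _ (A.sum_cellCoord i x)] at h
  rw [← show _ = p x from congrArg p (A.sum_cellCoord_smul i x)]
  exact h

theorem eq_nodalField (p : Vec →ᵃ[ℝ] Mat) (i : Fin 4) :
    p = A.nodalField i fun j => p (A.cellBasis i j) := by
  ext1 x
  rw [nodalField_apply]
  exact A.apply_eq_sum_cellCoord p i x

theorem cellCoord_add (i j : Fin 4) (x v : Vec) :
    A.cellCoord i j (x + v) = A.cellCoord i j x +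
      (if j = i then A.grad i else A.weight j • (A.grad j - A.grad i)) ⬝ᵥ v.ofLp := by
  have hg : ∀ j, A.gam j (x + v) = A.gam j x + A.grad j ⬝ᵥ v.ofLp := fun j => by
    rw [gam, gam, add_sub_right_comm, WithLp.ofLp_add, dotProduct_add]
  rw [cellCoord, cellCoord, hg, hg]
  split_ifs
  · ring
  · rw [smul_dotProduct, sub_dotProduct, smul_eq_mul]
    ring

/-- On `T_i` the barycentric coordinate of the split point has gradient `g_i`, that of `x_j` has
gradient `w_j (g_j - g_i)`. -/
theorem matDiv_nodalField (i : Fin 4) (E : Fin 4 → Mat) :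
    matDiv (A.nodalField i E) = A.nodalDiv i E := by
  set u : Fin 4 → Fin 3 → ℝ := fun j =>
    if j = i then A.grad i else A.weight j • (A.grad j - A.grad i) with hu
  have hlin : ∀ v, (A.nodalField i E).linear v = ∑ j, (u j ⬝ᵥ v.ofLp) • E j := by
    intro v
    have h := (A.nodalField i E).map_vadd 0 v
    rw [vadd_eq_add, vadd_eq_add, add_comm v] at h
    rw [eq_sub_iff_add_eq.2 h.symm, nodalField_apply, nodalField_apply,
      ← Finset.sum_sub_distrib]
    refine Finset.sum_congr rfl fun j _ => ?_
    rw [← sub_smul, cellCoord_add, add_sub_cancel_left]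
  have h2 : A.nodalDiv i E = ∑ j, E j *ᵥ u j := by
    rw [nodalDiv, ← Finset.add_sum_erase _ _ (Finset.mem_univ i), sub_self, mulVec_zero, smul_zero,
      zero_add, ← Finset.add_sum_erase (f := fun j => E j *ᵥ u j) _ (Finset.mem_univ i)]
    congr 1
    · simp [hu]
    · refine Finset.sum_congr rfl fun j hj => ?_
      rw [hu]
      simp only [if_neg (Finset.ne_of_mem_erase hj), mulVec_smul]
  ext r
  rw [h2]
  have h3 : ∀ c, (rowPiece (A.nodalField i E) r).linear (EuclideanSpace.single c 1) c =
      ∑ j, u j c * E j r c := by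
    intro c
    have : (rowPiece (A.nodalField i E) r).linear (EuclideanSpace.single c 1) c =
      (A.nodalField i E).linear (EuclideanSpace.single c 1) r c := rfl
    rw [this, hlin]
    simp [Matrix.sum_apply]
  simp only [matDiv, vdiv, h3, Finset.sum_apply, mulVec, dotProduct]
  rw [Finset.sum_comm]
  simp only [mul_comm]

/-- Where `gam i = gam k`, the coordinate of the vertex not shared by the other cell vanishes and
the coordinates of the shared nodes agree. The jump is then a combination of nodal jumps. -/
theorem normalContinuous_nodalField {E : Fin 4 → Fin 4 → Mat} {a b : Fin 3 → ℝ}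
    (h : A.IsNodalStress E a b) : A.NormalContinuous fun i => A.nodalField i (E i) := by
  intro i k x hx
  rcases eq_or_ne i k with rfl | hik
  · simp
  have hexp : ∀ i k, i ≠ k → A.gam i x = A.gam k x → (∑ j, A.cellCoord i j x • E i j) =
      (1 + A.gam i x) • E i i + ∑ j, (if j = i ∨ j = k then (0 : ℝ) else
        A.weight j * (A.gam j x - A.gam i x)) • E i j := by
    intro i k hik hx
    rw [← Finset.add_sum_erase _ _ (Finset.mem_univ i),
      ← Finset.add_sum_erase (f := fun j => (if j = i ∨ j = k then (0 : ℝ) else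
        A.weight j * (A.gam j x - A.gam i x)) • E i j) _ (Finset.mem_univ i)]
    simp only [cellCoord, true_or, if_true, zero_smul, zero_add]
    congr 1
    refine Finset.sum_congr rfl fun j hj => ?_
    have hj' := Finset.ne_of_mem_erase hj
    rcases eq_or_ne j k with rfl | hk
    · simp [hj', hx]
    · simp [hj', hk]
  simp only [nodalField_apply]
  rw [hexp i k hik hx, hexp k i hik.symm hx.symm, ← hx, add_sub_add_comm, ← smul_sub,
    ← Finset.sum_sub_distrib, add_mulVec, smul_mulVec, h.cont_split, smul_zero, zero_add,
    sum_mulVec]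
  refine Finset.sum_eq_zero fun j _ => ?_
  by_cases hj : j = i ∨ j = k
  · simp [hj, or_comm]
  · rw [if_neg hj, if_neg fun h => hj h.symm, ← smul_sub, smul_mulVec]
    push Not at hj
    rw [h.cont_vertex i k j hj.1 hj.2, smul_zero]

/-! ### The normals -/

/-- The altitude vector `u` has the same product `K` with `vtx j` for all `j ≠ i`. Expanding `u` by
`sum_smul_grad` and subtracting `K • ∑ w_j g_j = 0` leaves only the multiple of `grad i`. -/
theorem exists_normal_eq (i : Fin 4) : ∃ c : ℝ, c ≠ 0 ∧ (A.normal i).ofLp = c • A.grad i := by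
  set u : Vec := A.simplex.altitudeFoot i - A.simplex.points i with hu
  have hu0 : u ≠ 0 := sub_ne_zero.2 (A.simplex.ne_altitudeFoot i).symm
  have h1 : ∀ j, j ≠ i → A.vtx j ⬝ᵥ u.ofLp =
      (A.simplex.altitudeFoot i - A.z).ofLp ⬝ᵥ u.ofLp := by
    intro j hj
    have h : inner ℝ (A.simplex.points j -ᵥ A.simplex.altitudeFoot i)
        (A.simplex.points i -ᵥ A.simplex.altitudeFoot i) = 0 :=
      A.simplex.inner_vsub_altitudeFoot_vsub_altitudeFoot_eq_zero hj.symm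
    rw [vsub_eq_sub, vsub_eq_sub, ← neg_sub (A.simplex.altitudeFoot i) (A.simplex.points i),
      inner_neg_right, neg_eq_zero, EuclideanSpace.inner_eq_star_dotProduct] at h
    simp only [star_trivial] at h
    rw [dotProduct_comm, ← hu] at h
    rw [vtx, ← sub_eq_zero, ← sub_dotProduct, ← h, ← WithLp.ofLp_sub]
    congr 2
    abel
  set K := (A.simplex.altitudeFoot i - A.z).ofLp ⬝ᵥ u.ofLp
  have h2 : u.ofLp = (A.weight i * (A.vtx i ⬝ᵥ u.ofLp - K)) • A.grad i := by
    have e1 := A.sum_smul_grad u.ofLp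
    have e2 := congrArg (K • ·) A.sum_weight_smul_grad
    simp only [Finset.smul_sum, smul_zero, smul_smul] at e2
    conv_lhs => rw [← e1, ← sub_zero (∑ i, _), ← e2, ← Finset.sum_sub_distrib]
    rw [Finset.sum_eq_single i]
    · rw [← sub_smul]
      congr 1
      ring
    · intro j _ hj
      rw [h1 j hj, mul_comm, sub_self]
    · simp
  have hn : ‖u‖ ≠ 0 := norm_ne_zero_iff.2 hu0
  refine ⟨‖u‖⁻¹ * (A.weight i * (A.vtx i ⬝ᵥ u.ofLp - K)), ?_, ?_⟩
  · refine mul_ne_zero (inv_ne_zero hn) fun h => hu0 ?_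
    rw [h, zero_smul] at h2
    ext c
    exact congrFun h2 c
  · rw [normal, ← hu, WithLp.ofLp_smul, h2, smul_smul]
    rw [← h2]

theorem norm_normal (i : Fin 4) : ‖A.normal i‖ = 1 := by
  have h : A.simplex.altitudeFoot i - A.simplex.points i ≠ 0 :=
    sub_ne_zero.2 (A.simplex.ne_altitudeFoot i).symm
  rw [normal, norm_smul, norm_inv, norm_norm, inv_mul_cancel₀ (norm_ne_zero_iff.2 h)]

theorem exists_grad_eq (i : Fin 4) : ∃ c : ℝ, A.grad i = c • (A.normal i).ofLp := by
  obtain ⟨c, hc, h⟩ := A.exists_normal_eq i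
  exact ⟨c⁻¹, by rw [h, smul_smul, inv_mul_cancel₀ hc, one_smul]⟩

/-! ### Piecewise continuous functions as elements of `L²` -/

theorem exists_Lp_of_pieces {F : Type*} [NormedAddCommGroup F] {f : Fin 4 → Vec → F}
    (hf : ∀ i, Continuous (f i)) :
    ∃ u : Lp F 2 A.vol, ∀ i, u =ᵐ[volume.restrict (A.cell i)] f i := by
  -- Indicators of the open cells are disjoint, so at almost every point of a cell exactly one
  -- summand survives.
  have hm : ∀ i, MemLp ((interior (A.cell i)).indicator (f i)) 2 A.vol := by
    intro i
    refine MemLp.indicator isOpen_interior.measurableSet ?_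
    obtain ⟨C, hC⟩ := A.isCompact_T.exists_bound_of_continuousOn (hf i).continuousOn
    refine MemLp.of_bound (hf i).aestronglyMeasurable C ?_
    exact (ae_restrict_iff' A.isCompact_T.isClosed.measurableSet).2
      (Filter.Eventually.of_forall hC)
  have hs : MemLp (fun x => ∑ i, (interior (A.cell i)).indicator (f i) x) 2 A.vol :=
    memLp_finsetSum _ fun i _ => hm i
  refine ⟨hs.toLp _, fun i => ?_⟩
  filter_upwards [A.ae_cell hs.coeFn_toLp i, A.ae_mem_interior_cell i] with x h1 h2
  rw [h1, Finset.sum_eq_single i, Set.indicator_of_mem h2]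
  · intro j _ hj
    exact Set.indicator_of_notMem (Set.disjoint_right.1 (A.interior_cell_disjoint hj) h2) _
  · simp

end AlfeldSplit

/-! ### Mean values of affine functions on a simplex -/

/-- The affine involution that swaps two vertices of a simplex. -/
def swapVertices (b : AffineBasis (Fin 4) ℝ Vec) (j k : Fin 4) (x : Vec) : Vec :=
  x + (b.coord j x - b.coord k x) • (b k - b j)

theorem coord_swapVertices (b : AffineBasis (Fin 4) ℝ Vec) {j k : Fin 4} (h : j ≠ k) (l : Fin 4)
    (x : Vec) : b.coord l (swapVertices b j k x) = b.coord (Equiv.swap j k l) x := by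
  have h1 : b.coord l (swapVertices b j k x) =
      b.coord l x + (b.coord j x - b.coord k x) * (b.coord l (b k) - b.coord l (b j)) := by
    have e1 := (b.coord l).map_vadd x ((b.coord j x - b.coord k x) • (b k - b j))
    have e2 := (b.coord l).linearMap_vsub (b k) (b j)
    rw [vsub_eq_sub, vsub_eq_sub] at e2
    rw [vadd_eq_add, vadd_eq_add, map_smul, smul_eq_mul, e2] at e1
    rw [swapVertices, add_comm, e1, add_comm]
  rw [h1, b.coord_apply, b.coord_apply]
  rcases eq_or_ne l j with rfl | hj
  · simp [h]
  · rcases eq_or_ne l k with rfl | hk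
    · simp [hj]
    · simp [hj, hk, Equiv.swap_apply_of_ne_of_ne hj hk]

theorem swapVertices_swapVertices (b : AffineBasis (Fin 4) ℝ Vec) {j k : Fin 4} (h : j ≠ k)
    (x : Vec) : swapVertices b j k (swapVertices b j k x) = x :=
  b.ext_elem fun l => by simp [coord_swapVertices b h]

theorem swapVertices_eq (b : AffineBasis (Fin 4) ℝ Vec) (j k : Fin 4) :
    ∃ (L : Vec →ₗ[ℝ] Vec) (c : Vec), ∀ x, swapVertices b j k x = L x + c := by
  refine ⟨LinearMap.id + ((b.coord j).linear - (b.coord k).linear).smulRight (b k - b j),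
    (b.coord j 0 - b.coord k 0) • (b k - b j), fun x => ?_⟩
  have e : ∀ l, b.coord l x = (b.coord l).linear x + b.coord l 0 := fun l =>
    congrFun (b.coord l).decomp x
  rw [swapVertices, e j, e k]
  simp only [LinearMap.add_apply, LinearMap.id_apply, LinearMap.smulRight_apply,
    LinearMap.sub_apply]
  module

/-- The linear part of an affine involution squares to the identity, so its determinant has absolute
value one. -/
theorem measurePreserving_swapVertices (b : AffineBasis (Fin 4) ℝ Vec) {j k : Fin 4} (h : j ≠ k) :
    MeasurePreserving (swapVertices b j k) := by
  obtain ⟨L, c, hL⟩ := swapVertices_eq b j k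
  have hLL : L ∘ₗ L = LinearMap.id := by
    have h0 := swapVertices_swapVertices b h 0
    ext1 x
    have h1 := swapVertices_swapVertices b h x
    simp only [hL, map_add, map_zero, zero_add] at h0 h1
    rw [add_assoc, h0, add_zero] at h1
    exact h1
  have hdet : LinearMap.det L * LinearMap.det L = 1 := by
    rw [← LinearMap.det_comp, hLL, LinearMap.det_id]
  have habs : |(LinearMap.det L)⁻¹| = 1 := by
    have : |LinearMap.det L| * |LinearMap.det L| = 1 := by rw [← abs_mul, hdet, abs_one]
    have h2 : |LinearMap.det L| = 1 := by nlinarith [abs_nonneg (LinearMap.det L)]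
    rw [abs_inv, h2, inv_one]
  have hm : MeasurePreserving L := by
    refine ⟨L.continuous_of_finiteDimensional.measurable, ?_⟩
    rw [Measure.map_linearMap_addHaar_eq_smul_addHaar _ (left_ne_zero_of_mul_eq_one hdet), habs,
      ENNReal.ofReal_one, one_smul]
  have := (measurePreserving_add_right volume c).comp hm
  have e : swapVertices b j k = (fun x => x + c) ∘ L := funext hL
  rw [e]
  exact this

theorem integral_coord_swap (b : AffineBasis (Fin 4) ℝ Vec) (j k : Fin 4) :
    ∫ x in convexHull ℝ (Set.range b), b.coord j x =
      ∫ x in convexHull ℝ (Set.range b), b.coord k x := by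
  rcases eq_or_ne j k with rfl | h
  · rfl
  have hS : MeasurableSet (convexHull ℝ (Set.range b)) :=
    ((Set.finite_range b).isCompact_convexHull ℝ).isClosed.measurableSet
  have hmp := measurePreserving_swapVertices b h
  have hinj : Function.Injective (swapVertices b j k) :=
    (Function.LeftInverse.injective (swapVertices_swapVertices b h))
  have hcont : Continuous (swapVertices b j k) := by
    obtain ⟨L, c, hL⟩ := swapVertices_eq b j k
    rw [funext hL]
    exact L.continuous_of_finiteDimensional.add continuous_const
  have hemb : MeasurableEmbedding (swapVertices b j k) :=
    hcont.measurableEmbedding hinj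
  have h1 := hmp.setIntegral_preimage_emb hemb (fun x => b.coord k x) (convexHull ℝ (Set.range b))
  rw [← h1]
  have hpre : swapVertices b j k ⁻¹' (convexHull ℝ (Set.range b)) = convexHull ℝ (Set.range b) := by
    ext x
    rw [Set.mem_preimage, AffineBasis.convexHull_eq_nonneg_coord]
    simp only [Set.mem_ofPred_eq, coord_swapVertices b h]
    exact (Equiv.swap j k).forall_congr_left.trans (by simp)
  rw [hpre]
  refine setIntegral_congr_fun hS fun x _ => ?_
  simp [coord_swapVertices b h]

/-- The four coordinates have equal integrals by the vertex swaps, and they sum to one. -/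
theorem integral_coord (b : AffineBasis (Fin 4) ℝ Vec) (j : Fin 4) :
    ∫ x in convexHull ℝ (Set.range b), b.coord j x =
      volume.real (convexHull ℝ (Set.range b)) / 4 := by
  have hk : IsCompact (convexHull ℝ (Set.range b)) := (Set.finite_range b).isCompact_convexHull ℝ
  have h : ∑ k, ∫ x in convexHull ℝ (Set.range b), b.coord k x =
      volume.real (convexHull ℝ (Set.range b)) := by
    rw [← integral_finsetSum _ fun k _ =>
      ((b.coord k).continuous_of_finiteDimensional.continuousOn.integrableOn_compact hk)]
    simp [AffineBasis.sum_coord_apply_eq_one]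
  simp only [fun k => integral_coord_swap b k j] at h
  rw [← h]
  simp

namespace AlfeldSplit
variable (A : AlfeldSplit)
open Matrix

theorem cellCoord_center (i j : Fin 4) : A.cellCoord i j (A.center i) = 4⁻¹ := by
  have hs : ∑ _j : Fin 4, (4⁻¹ : ℝ) = 1 := by norm_num
  have h := (A.cellBasis i).coord_apply_combination_of_mem (Finset.mem_univ j) hs
  rw [Finset.affineCombination_eq_linear_combination _ _ _ hs, ← Finset.smul_sum] at h
  rw [← cellBasis_coord]
  exact h

/-- The mean value of an affine function over a cell is its value at the barycenter. -/
theorem integral_cell_affine (i : Fin 4) (f : Vec →ᵃ[ℝ] ℝ) :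
    ∫ x in A.cell i, f x = volume.real (A.cell i) * f (A.center i) := by
  have hk : IsCompact (A.cell i) := (Set.finite_range _).isCompact_convexHull ℝ
  rw [A.apply_eq_sum_cellCoord f i (A.center i)]
  rw [integral_congr_ae (Filter.Eventually.of_forall (A.apply_eq_sum_cellCoord f i))]
  have hc : ∀ j, Continuous (A.cellCoord i j) := fun j => by
    have : A.cellCoord i j = (A.cellBasis i).coord j := by
      ext1 x; exact (A.cellBasis_coord i j x).symm
    rw [this]
    exact ((A.cellBasis i).coord j).continuous_of_finiteDimensional
  have hi : ∀ j ∈ Finset.univ, Integrable (fun x => A.cellCoord i j x • f (A.cellBasis i j))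
      (volume.restrict (A.cell i)) := fun j _ =>
    ((hc j).smul continuous_const).continuousOn.integrableOn_compact hk
  rw [integral_finsetSum _ hi, Finset.mul_sum]
  refine Finset.sum_congr rfl fun j _ => ?_
  have h := integral_coord (A.cellBasis i) j
  simp only [cellBasis_coord] at h
  have h' : ∫ x in A.cell i, A.cellCoord i j x = volume.real (A.cell i) / 4 := h
  simp only [smul_eq_mul, cellCoord_center]
  rw [integral_mul_const, h']
  ring

/-! ### The projected rigid displacements -/

/-- The cross product with a fixed vector. -/
def crossLin (b : Vec) : Vec →ₗ[ℝ] Vec where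
  toFun := cross b
  map_add' := cross_add_right b
  map_smul' c x := cross_smul_right c b x

/-- The rigid displacement `x ↦ a + b × x`. -/
def rigid (a b : Vec) : Vec →ᵃ[ℝ] Vec := AffineMap.const ℝ Vec a + (crossLin b).toAffineMap

@[simp] theorem rigid_apply (a b x : Vec) : rigid a b x = a + cross b x := rfl

theorem inner_eq_sum_cell (u v : A.L2Vec) :
    inner ℝ u v = ∑ i, ∫ x in A.cell i, inner ℝ (u x) (v x) := by
  rw [L2.inner_def]
  exact A.integral_vol (L2.integrable_inner u v)

theorem inner_eq_of_rigid {a b : Vec} {v m : A.L2Vec} (hv : v =ᵐ[A.vol] rigid a b)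
    {c : Fin 4 → Vec} (hm : ∀ i, m =ᵐ[volume.restrict (A.cell i)] fun _ => c i) :
    inner ℝ v m = ∑ i, volume.real (A.cell i) * inner ℝ (rigid a b (A.center i)) (c i) := by
  rw [inner_eq_sum_cell]
  refine Finset.sum_congr rfl fun i _ => ?_
  have h := A.integral_cell_affine i
    (((innerSL ℝ (c i)).toLinearMap.toAffineMap).comp (rigid a b))
  have e : ∀ x, (((innerSL ℝ (c i)).toLinearMap.toAffineMap).comp (rigid a b)) x =
      inner ℝ (rigid a b x) (c i) := fun x => real_inner_comm (rigid a b x) (c i)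
  simp only [e] at h
  rw [← h]
  refine integral_congr_ae ?_
  filter_upwards [A.ae_cell hv i, hm i] with x h1 h2
  rw [h1, h2]

theorem inner_eq_of_const {w m : A.L2Vec} {c c' : Fin 4 → Vec}
    (hw : ∀ i, w =ᵐ[volume.restrict (A.cell i)] fun _ => c' i)
    (hm : ∀ i, m =ᵐ[volume.restrict (A.cell i)] fun _ => c i) :
    inner ℝ w m = ∑ i, volume.real (A.cell i) * inner ℝ (c' i) (c i) := by
  rw [inner_eq_sum_cell]
  refine Finset.sum_congr rfl fun i _ => ?_
  have : ∫ x in A.cell i, inner ℝ (w x) (m x) = ∫ _ in A.cell i, inner ℝ (c' i) (c i) := by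
    refine integral_congr_ae ?_
    filter_upwards [hw i, hm i] with x h1 h2
    rw [h1, h2]
  rw [this]
  simp

/-- The elements of `P_T R(T)` are the samples of the rigid displacements at the barycenters. -/
theorem mem_PTR_iff {w : A.L2Vec} : w ∈ A.PTR ↔
    ∃ a b, ∀ i, w =ᵐ[volume.restrict (A.cell i)] fun _ => a + cross b (A.center i) := by
  constructor
  · rintro ⟨v, ⟨a, b, hv⟩, hw, h⟩
    refine ⟨a, b, ?_⟩
    choose c hc using hw
    -- Testing with the difference between the constants `c i` and the barycenter values turns the
    -- projection identity into a vanishing weighted sum of squares.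
    obtain ⟨m, hm⟩ := A.exists_Lp_of_pieces
      (f := fun i _ => c i - rigid a b (A.center i)) fun i => continuous_const
    have h1 := h m fun i => ⟨_, hm i⟩
    rw [A.inner_eq_of_const hc hm, A.inner_eq_of_rigid hv hm, ← sub_eq_zero,
      ← Finset.sum_sub_distrib] at h1
    simp only [← mul_sub, ← inner_sub_left] at h1
    intro i
    have h2 := (Finset.sum_eq_zero_iff_of_nonneg fun i _ =>
      mul_nonneg (A.volume_cell_pos i).le real_inner_self_nonneg).1 h1 i (Finset.mem_univ i)
    have h3 := (mul_eq_zero.1 h2).resolve_left (A.volume_cell_pos i).ne'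
    rw [inner_self_eq_zero, sub_eq_zero] at h3
    have h4 := hc i
    rw [h3] at h4
    exact h4
  · rintro ⟨a, b, hw⟩
    obtain ⟨v, hv⟩ := A.exists_Lp_of_pieces (f := fun _ => rigid a b)
      fun _ => (rigid a b).continuous_of_finiteDimensional
    have hv' : v =ᵐ[A.vol] rigid a b := A.ae_vol_iff.2 hv
    refine ⟨v, ⟨a, b, hv'⟩, fun i => ⟨_, hw i⟩, fun m hm => ?_⟩
    choose c hc using hm
    rw [A.inner_eq_of_const hw hc, A.inner_eq_of_rigid hv' hc]
    rfl

/-! ### The surface measure -/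

theorem mem_facet_iff {i : Fin 4} {x : Vec} :
    x ∈ A.facet i ↔ A.basis.coord i x = 0 ∧ ∀ j, 0 ≤ A.basis.coord j x := by
  constructor
  · intro h
    refine (convexHull_min (t := {x | A.basis.coord i x = 0 ∧ ∀ j, 0 ≤ A.basis.coord j x})
      ?_ ?_) h
    · rintro _ ⟨k, hk, rfl⟩
      have e : ∀ j, A.basis.coord j (A.simplex.points k) = if j = k then 1 else 0 := fun j =>
        A.basis.coord_apply j k
      refine ⟨by rw [e, if_neg (Ne.symm hk)], fun j => ?_⟩
      rw [e]
      split_ifs <;> norm_num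
    · have : {x | A.basis.coord i x = 0 ∧ ∀ j, 0 ≤ A.basis.coord j x} =
          (A.basis.coord i ⁻¹' {0}) ∩ ⋂ j, A.basis.coord j ⁻¹' Set.Ici 0 := by
        ext x
        simp
      rw [this]
      exact ((convex_singleton 0).affine_preimage _).inter
        (convex_iInter fun j => (convex_Ici 0).affine_preimage _)
  · rintro ⟨h0, h⟩
    have e := A.basis.linear_combination_coord_eq_self x
    have es := A.basis.sum_coord_apply_eq_one x
    rw [← Finset.add_sum_erase _ _ (Finset.mem_univ i), h0] at e es
    rw [zero_smul, zero_add] at e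
    rw [zero_add] at es
    rw [← e]
    exact (convex_convexHull ℝ _).sum_mem (fun j _ => h j) es fun j hj =>
      subset_convexHull ℝ _ ⟨j, Finset.ne_of_mem_erase hj, rfl⟩

theorem isCompact_facet (i : Fin 4) : IsCompact (A.facet i) :=
  ((Set.toFinite _).image _).isCompact_convexHull ℝ

instance (i : Fin 4) : CompactSpace (A.facet i) :=
  isCompact_iff_compactSpace.1 (A.isCompact_facet i)

theorem surface_apply (i : Fin 4) (U : Set (A.facet i)) :
    A.surface i U = (Measure.euclideanHausdorffMeasure 2 : Measure Vec) (Subtype.val '' U) :=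
  (MeasurableEmbedding.subtype_coe (A.isCompact_facet i).isClosed.measurableSet).comap_apply _ _

/-- The direction of the plane of the facet `F_i`. -/
def facetDir (i : Fin 4) : Submodule ℝ Vec := LinearMap.ker (A.basis.coord i).linear

theorem finrank_facetDir (i : Fin 4) : Module.finrank ℝ (A.facetDir i) = 2 := by
  have h := LinearMap.finrank_range_add_finrank_ker (A.basis.coord i).linear
  have hs : Function.Surjective (A.basis.coord i).linear :=
    (A.basis.coord i).linear_surjective_iff.2 (A.basis.surjective_coord i)
  rw [LinearMap.range_eq_top.2 hs] at h
  simp only [finrank_top, Module.finrank_self, finrank_euclideanSpace, Fintype.card_fin] at h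
  have h2 : Module.finrank ℝ (A.facetDir i) =
    Module.finrank ℝ (LinearMap.ker (A.basis.coord i).linear) := rfl
  omega

theorem exists_facet_point (i : Fin 4) :
    ∃ x, A.basis.coord i x = 0 ∧ ∀ j, j ≠ i → 0 < A.basis.coord j x := by
  have hs : ∑ j : Fin 4, (if j = i then (0 : ℝ) else 3⁻¹) = 1 := by
    rw [← Finset.add_sum_erase _ _ (Finset.mem_univ i), if_pos rfl,
      Finset.sum_congr rfl fun j hj => if_neg (Finset.ne_of_mem_erase hj)]
    simp
  refine ⟨Finset.univ.affineCombination ℝ A.basis fun j => if j = i then (0 : ℝ) else 3⁻¹, ?_,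
    fun j hj => ?_⟩
  · exact (A.basis.coord_apply_combination_of_mem (Finset.mem_univ i) hs).trans (if_pos rfl)
  · rw [A.basis.coord_apply_combination_of_mem (Finset.mem_univ j) hs, if_neg hj]
    norm_num

theorem coord_add_facetDir (i : Fin 4) (v : A.facetDir i) (x : Vec) :
    A.basis.coord i (v + x) = A.basis.coord i x := by
  have h := (A.basis.coord i).map_vadd x (v : Vec)
  rw [vadd_eq_add, show (A.basis.coord i).linear (v : Vec) = 0 from v.2, zero_vadd] at h
  exact h

/-- Translation embeds the direction plane isometrically, and on a two-dimensional Euclidean space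
the normalized Hausdorff measure is Lebesgue measure. Finiteness and positivity of `surface` are
read off there. -/
theorem hausdorff_image_facetDir (i : Fin 4) (x₀ : Vec) (s : Set (A.facetDir i)) :
    (Measure.euclideanHausdorffMeasure 2 : Measure Vec)
      ((fun v : A.facetDir i => (v : Vec) + x₀) '' s) = volume s := by
  have hiso : Isometry fun v : A.facetDir i => (v : Vec) + x₀ :=
    (IsometryEquiv.addRight x₀).isometry.comp isometry_subtype_coe
  rw [hiso.euclideanHausdorffMeasure_image]
  have := InnerProductSpace.euclideanHausdorffMeasure_eq_volume (V := A.facetDir i)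
  rw [finrank_facetDir] at this
  rw [this]

theorem surface_univ_lt_top (i : Fin 4) : A.surface i Set.univ < ⊤ := by
  obtain ⟨x₀, hx0, -⟩ := A.exists_facet_point i
  have hiso : Isometry fun v : A.facetDir i => (v : Vec) + x₀ :=
    (IsometryEquiv.addRight x₀).isometry.comp isometry_subtype_coe
  have himg : (fun v : A.facetDir i => (v : Vec) + x₀) ''
      ((fun v : A.facetDir i => (v : Vec) + x₀) ⁻¹' A.facet i) = A.facet i := by
    rw [Set.image_preimage_eq_iff]
    intro x hx
    refine ⟨⟨x - x₀, ?_⟩, sub_add_cancel x x₀⟩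
    change (A.basis.coord i).linear (x -ᵥ x₀) = 0
    rw [AffineMap.linearMap_vsub, hx0, (A.mem_facet_iff.1 hx).1, vsub_self]
  rw [surface_apply, Set.image_univ, Subtype.range_coe, ← himg, hausdorff_image_facetDir]
  exact (hiso.isClosedEmbedding.isCompact_preimage (A.isCompact_facet i)).measure_lt_top

instance (i : Fin 4) : IsFiniteMeasure (A.surface i) := ⟨A.surface_univ_lt_top i⟩

/-- A relatively open subset of the facet may touch only its boundary at the given point `x`; moving
slightly towards the relative interior point `x₀` yields a point around which the set contains an
open piece of the plane. -/
instance (i : Fin 4) : (A.surface i).IsOpenPosMeasure := by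
  refine ⟨fun U hU hne => ?_⟩
  obtain ⟨O, hO, rfl⟩ := isOpen_induced_iff.1 hU
  obtain ⟨⟨x, hx⟩, hxO⟩ := hne
  have hxO : x ∈ O := hxO
  obtain ⟨x₀, hx0, hx0'⟩ := A.exists_facet_point i
  obtain ⟨hx1, hx2⟩ := A.mem_facet_iff.1 hx
  obtain ⟨t, ht, htO⟩ : ∃ t : ℝ, t ∈ Set.Ioo (0 : ℝ) 1 ∧ AffineMap.lineMap x x₀ t ∈ O := by
    have hc : Continuous fun t : ℝ => AffineMap.lineMap x x₀ t := AffineMap.lineMap_continuous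
    have h1 : ∀ᶠ t : ℝ in nhds 0, AffineMap.lineMap x x₀ t ∈ O :=
      (hc.tendsto 0).eventually (hO.mem_nhds (by simpa using hxO))
    have h2 : ∀ᶠ t : ℝ in nhdsWithin 0 (Set.Ioi 0), AffineMap.lineMap x x₀ t ∈ O :=
      h1.filter_mono nhdsWithin_le_nhds
    obtain ⟨t, h3, h4⟩ := (h2.and (Ioo_mem_nhdsGT zero_lt_one)).exists
    exact ⟨t, h4, h3⟩
  have hcont : Continuous fun v : A.facetDir i => (v : Vec) + x₀ := by fun_prop
  set W : Set (A.facetDir i) := (fun v : A.facetDir i => (v : Vec) + x₀) ⁻¹'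
    (O ∩ ⋂ j, ⋂ _ : j ≠ i, {x | 0 < A.basis.coord j x}) with hW
  have hWo : IsOpen W := by
    refine (hO.inter ?_).preimage hcont
    exact isOpen_iInter_of_finite fun j => isOpen_iInter_of_finite fun _ =>
      isOpen_lt continuous_const (A.basis.coord j).continuous_of_finiteDimensional
  have hWn : W.Nonempty := by
    refine ⟨⟨AffineMap.lineMap x x₀ t - x₀, ?_⟩, ?_⟩
    · change (A.basis.coord i).linear (AffineMap.lineMap x x₀ t -ᵥ x₀) = 0
      rw [AffineMap.linearMap_vsub, AffineMap.apply_lineMap, hx0, hx1]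
      simp
    · rw [hW, Set.mem_preimage]
      simp only [sub_add_cancel]
      refine ⟨htO, Set.mem_iInter₂.2 fun j hj => ?_⟩
      change 0 < A.basis.coord j (AffineMap.lineMap x x₀ t)
      rw [AffineMap.apply_lineMap, AffineMap.lineMap_apply_module, smul_eq_mul, smul_eq_mul]
      have := mul_nonneg (sub_nonneg.2 ht.2.le) (hx2 j)
      have := mul_pos ht.1 (hx0' j hj)
      linarith
  have hpos := hWo.measure_pos volume hWn
  rw [← A.hausdorff_image_facetDir i x₀] at hpos
  refine (hpos.trans_le ?_).ne'
  rw [surface_apply]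
  refine measure_mono ?_
  rintro _ ⟨v, hv, rfl⟩
  have h0 : A.basis.coord i (v + x₀) = 0 := (A.coord_add_facetDir i v x₀).trans hx0
  refine ⟨⟨v + x₀, A.mem_facet_iff.2 ⟨h0, fun j => ?_⟩⟩, hv.1, rfl⟩
  rcases eq_or_ne j i with rfl | hj
  · exact h0.ge
  · exact (Set.mem_iInter₂.1 hv.2 j hj).le

/-! ### Riesz representation in spaces of continuous functions -/

theorem eq_zero_of_forall_integral_inner {X E : Type*} [TopologicalSpace X] [CompactSpace X]
    [MeasurableSpace X] [OpensMeasurableSpace X] (μ : Measure X) [IsFiniteMeasure μ]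
    [μ.IsOpenPosMeasure] [NormedAddCommGroup E] [InnerProductSpace ℝ E]
    {u : X → E} (hu : Continuous u) (h : ∫ x, inner ℝ (u x) (u x) ∂μ = 0) : u = 0 := by
  have hc : Continuous fun x => inner ℝ (u x) (u x) := hu.inner hu
  rw [integral_eq_zero_iff_of_nonneg (fun x => real_inner_self_nonneg)
    (hc.integrable_of_hasCompactSupport (HasCompactSupport.of_compactSpace _))] at h
  have h2 := (hc.ae_eq_iff_eq μ continuous_const).1 h
  ext1 x
  exact inner_self_eq_zero.1 (congrFun h2 x)

/-- On a finite-dimensional space of continuous functions the L² form is definite, because the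
measure charges open sets. The map to the dual is therefore injective, hence onto. -/
theorem exists_integral_inner_eq {X E : Type*} [TopologicalSpace X] [CompactSpace X]
    [MeasurableSpace X] [OpensMeasurableSpace X] (μ : Measure X) [IsFiniteMeasure μ]
    [μ.IsOpenPosMeasure] [NormedAddCommGroup E] [InnerProductSpace ℝ E]
    (K : Submodule ℝ (X → E)) [FiniteDimensional ℝ K] (hK : ∀ u ∈ K, Continuous u)
    (f : K →ₗ[ℝ] ℝ) : ∃ u : K, ∀ κ : K, ∫ x, inner ℝ ((u : X → E) x) ((κ : X → E) x) ∂μ = f κ := by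
  have hint : ∀ u v : K, Integrable (fun x => inner ℝ ((u : X → E) x) ((v : X → E) x)) μ :=
    fun u v => ((hK u u.2).inner (hK v v.2)).integrable_of_hasCompactSupport
      (HasCompactSupport.of_compactSpace _)
  let B : K →ₗ[ℝ] Module.Dual ℝ K := LinearMap.mk₂ ℝ
    (fun u v => ∫ x, inner ℝ ((u : X → E) x) ((v : X → E) x) ∂μ)
    (fun u u' v => by
      rw [← integral_add (hint u v) (hint u' v)]
      simp [inner_add_left])
    (fun c u v => by
      rw [smul_eq_mul, ← integral_const_mul]
      simp [real_inner_smul_left])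
    (fun u v v' => by
      rw [← integral_add (hint u v) (hint u v')]
      simp [inner_add_right])
    (fun c u v => by
      rw [smul_eq_mul, ← integral_const_mul]
      simp [real_inner_smul_right])
  have hinj : Function.Injective B := by
    rw [injective_iff_map_eq_zero]
    intro u hu
    exact Subtype.ext (eq_zero_of_forall_integral_inner μ (hK u u.2) (LinearMap.congr_fun hu u))
  obtain ⟨u, hu⟩ := (LinearMap.injective_iff_surjective_of_finrank_eq_finrank
    (Subspace.dual_finrank_eq).symm).1 hinj f
  exact ⟨u, fun κ => LinearMap.congr_fun hu κ⟩

end AlfeldSplit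

/-! ### The test spaces on the facets and their dimensions -/

open Matrix

theorem cross_cross_of_norm_eq_one {n : Vec} (hn : ‖n‖ = 1) (v : Vec) :
    cross n (cross v n) = v - inner ℝ v n • n := by
  have h1 : n.ofLp ⬝ᵥ n.ofLp = 1 := by
    have := real_inner_self_eq_norm_sq n
    rw [hn, EuclideanSpace.inner_eq_star_dotProduct] at this
    simpa using this
  have h2 : inner ℝ v n = n.ofLp ⬝ᵥ v.ofLp := by
    rw [EuclideanSpace.inner_eq_star_dotProduct]
    simp
  apply WithLp.ofLp_injective 2
  rw [WithLp.ofLp_sub, WithLp.ofLp_smul, h2]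
  simp only [cross]
  ext c
  simp only [vec3_dotProduct] at h1 ⊢
  simp only [cross_apply]
  fin_cases c <;> simp <;> linear_combination (v.ofLp _) * h1

theorem inner_cross_self (n x : Vec) : inner ℝ (cross n x) n = 0 := by
  rw [EuclideanSpace.inner_eq_star_dotProduct]
  simp [cross]

namespace AlfeldSplit
variable (A : AlfeldSplit)

theorem vertex_mem_facet {i j : Fin 4} (h : j ≠ i) : A.simplex.points j ∈ A.facet i :=
  subset_convexHull ℝ _ ⟨j, h, rfl⟩

theorem continuous_of_mem_P1 {i : Fin 4} {κ : A.facet i → ℝ} (h : κ ∈ A.P1 i) : Continuous κ := by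
  obtain ⟨p, hp⟩ := h
  rw [funext hp]
  exact p.continuous_of_finiteDimensional.comp continuous_subtype_val

theorem continuous_of_mem_RF {i : Fin 4} {κ : A.facet i → Vec} (h : κ ∈ A.RF i) :
    Continuous κ := by
  obtain ⟨a, β, -, hκ⟩ := h
  rw [funext hκ]
  have h : Continuous fun x : A.facet i => cross (A.normal i) x :=
    (crossLin (A.normal i)).continuous_of_finiteDimensional.comp continuous_subtype_val
  exact continuous_const.add (h.const_smul β)

theorem inner_normal_of_mem_RF {i : Fin 4} {κ : A.facet i → Vec} (h : κ ∈ A.RF i) (x : A.facet i) :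
    inner ℝ (κ x) (A.normal i) = 0 := by
  obtain ⟨a, β, ha, hκ⟩ := h
  rw [hκ, inner_add_left, ha, real_inner_smul_left, inner_cross_self, mul_zero, add_zero]

/-- Evaluation at the vertices of a facet. -/
def evalP1 (i : Fin 4) : A.P1 i →ₗ[ℝ] ({j // j ≠ i} → ℝ) where
  toFun κ j := (κ : A.facet i → ℝ) ⟨A.simplex.points j, A.vertex_mem_facet j.2⟩
  map_add' _ _ := rfl
  map_smul' _ _ := rfl

/-- On the facet `F_i` the coordinate of `x_i` vanishes, so an affine function is interpolated by
its values at the other three vertices. -/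
theorem evalP1_bijective (i : Fin 4) : Function.Bijective (A.evalP1 i) := by
  have hexp : ∀ (p : Vec →ᵃ[ℝ] ℝ) (x : Vec),
      p x = ∑ j, A.basis.coord j x * p (A.simplex.points j) := by
    intro p x
    have h := Finset.univ.map_affineCombination A.basis (fun j => A.basis.coord j x)
      (A.basis.sum_coord_apply_eq_one x) p
    rw [AffineBasis.affineCombination_coord_eq_self,
      Finset.affineCombination_eq_linear_combination _ _ _ (A.basis.sum_coord_apply_eq_one x)] at h
    exact h
  constructor
  · rw [injective_iff_map_eq_zero]
    rintro ⟨κ, p, hp⟩ h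
    ext x
    change κ x = 0
    rw [hp, hexp]
    refine Finset.sum_eq_zero fun j _ => ?_
    rcases eq_or_ne j i with rfl | hj
    · rw [(A.mem_facet_iff.1 x.2).1, zero_mul]
    · have := congrFun h ⟨j, hj⟩
      change κ _ = 0 at this
      rw [hp] at this
      rw [this, mul_zero]
  · intro v
    let p : Vec →ᵃ[ℝ] ℝ := (Fintype.linearCombination ℝ v).toAffineMap.comp
      (AffineMap.pi fun j => A.basis.coord j)
    have hp : ∀ x, p x = ∑ j : {j // j ≠ i}, A.basis.coord j x * v j := fun x => by
      simp [p, Fintype.linearCombination_apply]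
    refine ⟨⟨fun x => p x, p, fun _ => rfl⟩, ?_⟩
    ext1 j
    change p (A.simplex.points j) = v j
    rw [hp, Finset.sum_eq_single j]
    · rw [show A.basis.coord j (A.simplex.points j) = 1 from A.basis.coord_apply_eq j, one_mul]
    · intro k _ hk
      rw [show A.basis.coord k (A.simplex.points j) = 0 from
        A.basis.coord_apply_ne fun h => hk (Subtype.ext h), zero_mul]
    · simp

instance (i : Fin 4) : FiniteDimensional ℝ (A.P1 i) :=
  (LinearEquiv.ofBijective _ (A.evalP1_bijective i)).symm.finiteDimensional

theorem finrank_P1 (i : Fin 4) : Module.finrank ℝ (A.P1 i) = 3 := by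
  rw [(LinearEquiv.ofBijective _ (A.evalP1_bijective i)).finrank_eq]
  simp

/-- The parametrization of the rigid motions of a facet. -/
def paramRF (i : Fin 4) : (ℝ ∙ A.normal i)ᗮ × ℝ →ₗ[ℝ] (A.facet i → Vec) where
  toFun X x := X.1 + X.2 • cross (A.normal i) x
  map_add' X Y := by
    ext1 x
    simp only [Prod.fst_add, Prod.snd_add, Submodule.coe_add, add_smul, Pi.add_apply]
    abel
  map_smul' c X := by
    ext1 x
    simp [mul_smul]

theorem range_paramRF (i : Fin 4) : LinearMap.range (A.paramRF i) = A.RF i := by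
  ext κ
  constructor
  · rintro ⟨⟨a, β⟩, rfl⟩
    refine ⟨a, β, ?_, fun _ => rfl⟩
    rw [real_inner_comm]
    exact Submodule.mem_orthogonal_singleton_iff_inner_right.1 a.2
  · rintro ⟨a, β, ha, hκ⟩
    refine ⟨(⟨a, ?_⟩, β), (funext hκ).symm⟩
    rw [Submodule.mem_orthogonal_singleton_iff_inner_right, real_inner_comm]
    exact ha

theorem inner_edge_normal {i j k : Fin 4} (hj : j ≠ i) (hk : k ≠ i) :
    inner ℝ (A.simplex.points j - A.simplex.points k) (A.normal i) = 0 := by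
  obtain ⟨c, -, hc⟩ := A.exists_normal_eq i
  have h : A.grad i ⬝ᵥ (A.vtx j - A.vtx k) = 0 := by
    rw [dotProduct_sub, grad_dot_vtx, grad_dot_vtx, if_neg hj.symm, if_neg hk.symm, sub_self]
  have h2 : A.vtx j - A.vtx k = (A.simplex.points j - A.simplex.points k).ofLp := by
    simp [vtx]
  rw [EuclideanSpace.inner_eq_star_dotProduct, hc]
  simp only [star_trivial]
  rw [smul_dotProduct, ← h2, h, smul_zero]

/-- The difference of the values at two vertices is `β n × e` for an edge `e` of the facet. As `e`
is nonzero and orthogonal to the unit vector `n`, `n × e ≠ 0`, so `β = 0` and then `a = 0`. -/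
theorem paramRF_injective (i : Fin 4) : Function.Injective (A.paramRF i) := by
  rw [injective_iff_map_eq_zero]
  rintro ⟨a, β⟩ h
  have hx : ∀ x : A.facet i, (a : Vec) + β • cross (A.normal i) x = 0 := fun x => congrFun h x
  obtain ⟨j, hj⟩ := exists_ne i
  obtain ⟨k, hk⟩ : ∃ k : Fin 4, k ≠ i ∧ k ≠ j := by
    clear hx h
    decide +revert
  have h1 := hx ⟨_, A.vertex_mem_facet hj⟩
  have h2 := hx ⟨_, A.vertex_mem_facet hk.1⟩
  set e := A.simplex.points j - A.simplex.points k with he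
  have he0 : e ≠ 0 := sub_ne_zero.2 fun h => hk.2 (A.simplex.independent.injective h).symm
  have h3 : β • cross (A.normal i) e = 0 := by
    have : cross (A.normal i) (A.simplex.points j) =
        cross (A.normal i) e + cross (A.normal i) (A.simplex.points k) := by
      rw [← cross_add_right, he, sub_add_cancel]
    simp only [this, smul_add] at h1
    simp only at h2
    rw [← h2, ← sub_eq_zero] at h1
    rw [← h1]
    abel
  have hβ : β = 0 := by
    refine (smul_eq_zero.1 h3).resolve_right fun h4 => he0 ?_
    have h5 := cross_cross_of_norm_eq_one (A.norm_normal i) e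
    have h6 : cross e (A.normal i) = 0 := by
      have : cross e (A.normal i) = -cross (A.normal i) e := by
        simp only [cross]
        rw [← cross_anticomm, WithLp.toLp_neg]
      rw [this, h4, neg_zero]
    rw [h6, cross_zero_right, inner_edge_normal A hj hk.1, zero_smul, sub_zero] at h5
    exact h5.symm
  subst hβ
  have ha : (a : Vec) = 0 := by simpa using h1
  exact Prod.ext (Subtype.ext ha) rfl

instance (i : Fin 4) : FiniteDimensional ℝ (A.RF i) := by
  rw [← range_paramRF]
  infer_instance

theorem finrank_RF (i : Fin 4) : Module.finrank ℝ (A.RF i) = 3 := by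
  have : Fact (Module.finrank ℝ Vec = 2 + 1) := ⟨by simp⟩
  rw [← range_paramRF, LinearMap.finrank_range_of_inj (A.paramRF_injective i),
    Module.finrank_prod, Submodule.finrank_orthogonal_span_singleton (n := 2)]
  · simp
  · intro h
    have := A.norm_normal i
    rw [h, norm_zero] at this
    exact zero_ne_one this

/-! ### The traces -/

theorem normalTrace_eq (ω : A.L2Mat) (i : Fin 4) (x : A.facet i) :
    A.normalTrace ω i x = WithLp.toLp 2 (A.piece ω i x *ᵥ (A.normal i).ofLp) := rfl

theorem normalTrace_eq_add (ω : A.L2Mat) (i : Fin 4) (x : A.facet i) :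
    A.normalTrace ω i x = A.traceNN ω i x • A.normal i + A.traceNT ω i x := by
  rw [traceNN, traceNT, cross_cross_of_norm_eq_one (A.norm_normal i)]
  abel

theorem traceNN_mem_P1 (ω : A.L2Mat) (i : Fin 4) : A.traceNN ω i ∈ A.P1 i := by
  let L : Mat →ₗ[ℝ] ℝ := (innerSL ℝ (A.normal i)).toLinearMap ∘ₗ
    (LinearMap.applyₗ (A.normal i)) ∘ₗ Matrix.toEuclideanLin.toLinearMap
  refine ⟨L.toAffineMap.comp (A.piece ω i), fun x => ?_⟩
  exact real_inner_comm (A.normal i) (A.normalTrace ω i x)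

theorem traceNN_add {ω ω' : A.L2Mat} (h : ω ∈ A.SigmaH) (h' : ω' ∈ A.SigmaH) (i : Fin 4) :
    A.traceNN (ω + ω') i = A.traceNN ω i + A.traceNN ω' i := by
  ext1 x
  simp only [traceNN, A.normalTrace_add h h', Pi.add_apply, inner_add_left]

theorem traceNN_smul (c : ℝ) {ω : A.L2Mat} (h : ω ∈ A.SigmaH) (i : Fin 4) :
    A.traceNN (c • ω) i = c • A.traceNN ω i := by
  ext1 x
  simp only [traceNN, A.normalTrace_smul c h, Pi.smul_apply, real_inner_smul_left, smul_eq_mul]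

theorem piece_isSymm {ω : A.L2Mat} (h : ω ∈ A.SigmaH) (i : Fin 4) (x : Vec) :
    (A.piece ω i x).IsSymm := by
  have hp : A.IsPiece ω i
      ((Matrix.transposeLinearEquiv (Fin 3) (Fin 3) ℝ ℝ).toLinearMap.toAffineMap.comp
        (A.piece ω i)) := by
    intro k l
    filter_upwards [A.piece_spec h i l k] with x hx
    rw [← h.1.apply, hx]
    rfl
  exact (DFunLike.congr_fun (A.piece_eq hp) x).symm

/-- The nodal values of `ω` form a nodal stress with zero traction, so the discrete uniqueness
result applies. -/
theorem eq_zero_of_normalTrace_eq_zero {ω : A.L2Mat} (h : ω ∈ A.SigmaR)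
    (h0 : ∀ i x, A.normalTrace ω i x = 0) : ω = 0 := by
  obtain ⟨hH, ⟨d, hd, hdiv⟩, -⟩ := h
  obtain ⟨a, b, hab⟩ := A.mem_PTR_iff.1 hd
  have hp : ∀ i, A.IsPiece ω i (A.piece ω i) := A.piece_spec hH
  have hv : ∀ i m, m ≠ i → A.cellBasis i m = A.simplex.points m := fun i m hm =>
    Function.update_of_ne hm _ _
  have hz : ∀ i, A.cellBasis i i = A.z := fun i => Function.update_self _ _ _
  have hN : A.IsNodalStress (fun i m => A.piece ω i (A.cellBasis i m)) a.ofLp b.ofLp := by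
    refine ⟨fun i m => A.piece_isSymm hH i _, fun i k m hi hk => ?_, fun i k => ?_, fun i => ?_⟩
    · simp only [hv i m hi, hv k m hk]
      exact A.vertex_jump hp hdiv hi hk
    · simp only [hz]
      exact A.split_jump hp hdiv i k
    · rw [← matDiv_nodalField, ← eq_nodalField]
      have hm := A.ae_eq_matDiv_of_isDiv hp hdiv i
      have : ∀ᵐ _ ∂volume.restrict (A.cell i),
          matDiv (A.piece ω i) = a.ofLp + crossProduct b.ofLp (A.center i).ofLp := by
        filter_upwards [hm, hab i] with x h1 h2
        rw [← h1, h2]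
        rfl
      -- The identity `this` is between constants and holds almost everywhere on a cell of positive
      -- volume, hence it holds outright.
      have hne : (ae (volume.restrict (A.cell i))).NeBot := by
        rw [ae_neBot, Ne, Measure.restrict_eq_zero]
        intro h
        have := A.volume_cell_pos i
        rw [Measure.real, h] at this
        exact lt_irrefl _ this
      exact this.exists.choose_spec
  obtain ⟨hE, -, -⟩ := hN.eq_zero fun i m hm => by
    obtain ⟨c, hc⟩ := A.exists_grad_eq i
    have := congrArg WithLp.ofLp (h0 i ⟨_, A.vertex_mem_facet hm⟩)
    rw [normalTrace_eq] at this
    simp only [hv i m hm]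
    rw [hc, mulVec_smul]
    exact smul_eq_zero_of_right _ this
  have hp0 : ∀ i, A.IsPiece ω i 0 := fun i => by
    have : A.piece ω i = 0 := by
      rw [A.eq_nodalField (A.piece ω i) i]
      ext1 x
      simp only [nodalField_apply, hE]
      simp
    rw [← this]
    exact hp i
  ext1 k l
  refine Lp.ext (A.ae_vol_iff.2 fun i => ?_)
  filter_upwards [hp0 i k l, A.ae_cell (Lp.coeFn_zero ℝ 2 A.vol) i] with x h1 h2
  rw [h1]
  exact h2.symm

theorem exists_mem_SigmaR (κ : ∀ i, A.P1 i) (ρ : ∀ i, A.RF i) :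
    ∃ ω ∈ A.SigmaR, ∀ i, A.traceNN ω i = κ i ∧ A.traceNT ω i = ρ i := by
  choose P hP using fun i => (κ i).2
  choose α β hα hρ using fun i => (ρ i).2
  choose c hc0 hc using A.exists_normal_eq
  -- The prescribed traction `κ n + ρ`, extended affinely to space. Because `normal i = c i • grad
  -- i`, its nodal values are divided by `c i` to become data for the nodal system.
  let t : Fin 4 → Vec →ᵃ[ℝ] Vec := fun i =>
    ((LinearMap.toSpanSingleton ℝ Vec (A.normal i)).toAffineMap.comp (P i)) +
      rigid (α i) (β i • A.normal i)
  have ht : ∀ i (x : A.facet i), t i x = (κ i : A.facet i → ℝ) x • A.normal i +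
      (ρ i : A.facet i → Vec) x := fun i x => by
    rw [hP, hρ, ← cross_smul_left]
    rfl
  obtain ⟨E, a, b, hN, hE⟩ := A.exists_isNodalStress fun i m =>
    (c i)⁻¹ • (t i (A.simplex.points m)).ofLp
  set p : Fin 4 → Vec →ᵃ[ℝ] Mat := fun i => A.nodalField i (E i) with hpdef
  have hcont : ∀ i k l, Continuous fun x => p i x k l := fun i k l => by
    exact ((Matrix.entryLinearMap ℝ ℝ k l).toAffineMap.comp (p i)).continuous_of_finiteDimensional
  obtain ⟨ω, hp⟩ : ∃ ω : A.L2Mat, ∀ i, A.IsPiece ω i (p i) := by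
    choose ω hω using fun k l => A.exists_Lp_of_pieces (f := fun i x => p i x k l)
      fun i => hcont i k l
    exact ⟨Matrix.of ω, fun i k l => hω k l i⟩
  have hpsymm : ∀ i x, (p i x).IsSymm := fun i x => by
    rw [hpdef]
    simp only [nodalField_apply]
    rw [Matrix.IsSymm, transpose_sum]
    exact Finset.sum_congr rfl fun j _ => ((hN.symm i j).smul _).eq
  have hsymm : ω.IsSymm := by
    ext1 k l
    refine Lp.ext (A.ae_vol_iff.2 fun i => ?_)
    filter_upwards [hp i k l, hp i l k] with x h1 h2
    rw [h1, transpose_apply, h2]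
    exact (hpsymm i x).apply k l
  obtain ⟨d, hd⟩ := A.exists_Lp_of_pieces
    (f := fun i _ => WithLp.toLp 2 a + cross (WithLp.toLp 2 b) (A.center i))
    fun i => continuous_const
  have hdiv : A.IsDiv ω d := by
    refine A.isDiv_of_normalContinuous hp (A.normalContinuous_nodalField hN) fun i => ?_
    filter_upwards [hd i] with x hx
    rw [hx, hpdef]
    simp only
    rw [matDiv_nodalField, hN.div_eq]
    rfl
  have hH : ω ∈ A.SigmaH := ⟨hsymm, ⟨d, hdiv⟩, fun i => ⟨p i, hp i⟩⟩
  have htr : ∀ i x, A.normalTrace ω i x = (κ i : A.facet i → ℝ) x • A.normal i +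
      (ρ i : A.facet i → Vec) x := by
    intro i x
    rw [normalTrace_eq, A.piece_eq (hp i), hpdef, ← ht, A.apply_eq_sum_cellCoord (t i) i x]
    simp only [nodalField_apply, sum_mulVec, WithLp.toLp_sum, smul_mulVec, WithLp.toLp_smul]
    refine Finset.sum_congr rfl fun j _ => ?_
    rcases eq_or_ne j i with rfl | hj
    -- On `F_i` the coordinate of the split point vanishes, so its nodal value, over which the
    -- boundary data have no control, does not enter the trace.
    · have h0 := (A.mem_facet_iff.1 x.2).1
      rw [coord_eq] at h0
      have h1 := (mul_eq_zero.1 h0).resolve_left (A.weight_pos j).ne'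
      rw [cellCoord, if_pos rfl, h1, zero_smul, zero_smul]
    · rw [hc, mulVec_smul, hE i j hj, smul_smul, mul_inv_cancel₀ (hc0 i), one_smul,
        cellBasis_apply, Function.update_of_ne hj]
  have hNN : ∀ i, A.traceNN ω i = κ i := fun i => by
    ext1 x
    rw [traceNN, htr, inner_add_left, A.inner_normal_of_mem_RF (ρ i).2, real_inner_smul_left,
      real_inner_self_eq_norm_sq, norm_normal]
    ring
  have hNT : ∀ i, A.traceNT ω i = ρ i := fun i => by
    ext1 x
    have h := A.normalTrace_eq_add ω i x
    rw [htr, hNN] at h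
    exact (add_left_cancel h).symm
  exact ⟨ω, ⟨hH, ⟨d, A.mem_PTR_iff.2 ⟨_, _, hd⟩, hdiv⟩, fun i => by rw [hNT]; exact (ρ i).2⟩,
    fun i => ⟨hNN i, hNT i⟩⟩

/-! ### The trace isomorphism and unisolvence -/

/-- The normal-normal and normal-tangential traces of the reduced stresses. -/
def traces : A.SigmaR →ₗ[ℝ] (∀ i, A.P1 i) × (∀ i, A.RF i) where
  toFun ω := (fun i => ⟨A.traceNN ω i, A.traceNN_mem_P1 ω i⟩, fun i => ⟨A.traceNT ω i, ω.2.2.2 i⟩)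
  map_add' ω ω' := Prod.ext
    (funext fun i => Subtype.ext (A.traceNN_add ω.2.1 ω'.2.1 i))
    (funext fun i => Subtype.ext (A.traceNT_add ω.2.1 ω'.2.1 i))
  map_smul' c ω := Prod.ext
    (funext fun i => Subtype.ext (A.traceNN_smul c ω.2.1 i))
    (funext fun i => Subtype.ext (A.traceNT_smul c ω.2.1 i))

theorem traces_injective : Function.Injective A.traces := by
  rw [injective_iff_map_eq_zero]
  intro ω h
  refine Subtype.ext (A.eq_zero_of_normalTrace_eq_zero ω.2 fun i x => ?_)
  have h1 : A.traceNN ω i x = 0 :=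
    congrFun (congrArg Subtype.val (congrFun (congrArg Prod.fst h) i)) x
  have h2 : A.traceNT ω i x = 0 :=
    congrFun (congrArg Subtype.val (congrFun (congrArg Prod.snd h) i)) x
  rw [normalTrace_eq_add, h1, h2, zero_smul, add_zero]

theorem traces_surjective : Function.Surjective A.traces := by
  rintro ⟨κ, ρ⟩
  obtain ⟨ω, hω, h⟩ := A.exists_mem_SigmaR κ ρ
  exact ⟨⟨ω, hω⟩, Prod.ext (funext fun i => Subtype.ext (h i).1)
    (funext fun i => Subtype.ext (h i).2)⟩

theorem finrank_SigmaR : Module.finrank ℝ A.SigmaR = 24 := by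
  rw [(LinearEquiv.ofBijective _ ⟨A.traces_injective, A.traces_surjective⟩).finrank_eq,
    Module.finrank_prod, Module.finrank_pi_fintype, Module.finrank_pi_fintype]
  simp [finrank_P1, finrank_RF]

/-- The difference `u - v` lies in the test space `K`, so it may serve as its own test function. -/
theorem eq_of_integral_inner_eq {i : Fin 4} {E : Type*} [NormedAddCommGroup E]
    [InnerProductSpace ℝ E] (K : Submodule ℝ (A.facet i → E)) (hK : ∀ u ∈ K, Continuous u)
    {u v : A.facet i → E} (hu : u ∈ K) (hv : v ∈ K)
    (h : ∀ κ ∈ K, ∫ x, inner ℝ (u x) (κ x) ∂A.surface i = ∫ x, inner ℝ (v x) (κ x) ∂A.surface i) :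
    u = v := by
  have hw := K.sub_mem hu hv
  rw [← sub_eq_zero]
  refine eq_zero_of_forall_integral_inner (A.surface i) (hK _ hw) ?_
  have hint : ∀ u' ∈ K, Integrable (fun x => inner ℝ (u' x) ((u - v) x)) (A.surface i) :=
    fun u' hu' => ((hK u' hu').inner (hK _ hw)).integrable_of_hasCompactSupport
      (HasCompactSupport.of_compactSpace _)
  have h1 := h _ hw
  rw [← sub_eq_zero, ← integral_sub (hint u hu) (hint v hv)] at h1
  simp only [← inner_sub_left] at h1
  exact h1

end AlfeldSplit

end JKM

end

theorem mainTheorem3 (A : JKM.AlfeldSplit) :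
    Module.finrank ℝ A.SigmaR = 24 ∧
    (∀ i, Module.finrank ℝ (A.P1 i) = 3 ∧ Module.finrank ℝ (A.RF i) = 3) ∧
    (∀ ω ∈ A.SigmaR, ∀ ω' ∈ A.SigmaR,
      (∀ i, ∀ κ ∈ A.P1 i, A.dofNN ω i κ = A.dofNN ω' i κ) →
      (∀ i, ∀ κ ∈ A.RF i, A.dofNT ω i κ = A.dofNT ω' i κ) → ω = ω') ∧
    (∀ (f : ∀ i, A.P1 i →ₗ[ℝ] ℝ) (g : ∀ i, A.RF i →ₗ[ℝ] ℝ),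
      ∃ ω ∈ A.SigmaR, (∀ i, ∀ κ : A.P1 i, A.dofNN ω i κ = f i κ) ∧
        ∀ i, ∀ κ : A.RF i, A.dofNT ω i κ = g i κ) := by
  -- Writing the product as a real inner product lets the scalar and the vector degrees of freedom
  -- use the same Riesz lemmas.
  have hcomm : ∀ a b : ℝ, a * b = inner ℝ a b := fun a b => by
    rw [real_inner_eq_re_inner]; simp [mul_comm]
  refine ⟨A.finrank_SigmaR, fun i => ⟨A.finrank_P1 i, A.finrank_RF i⟩, ?_, ?_⟩
  · intro ω hω ω' hω' h1 h2
    have hNN : ∀ i, A.traceNN ω i = A.traceNN ω' i := fun i =>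
      A.eq_of_integral_inner_eq (A.P1 i) (fun _ => A.continuous_of_mem_P1)
        (A.traceNN_mem_P1 ω i) (A.traceNN_mem_P1 ω' i) fun κ hκ => by
          have := h1 i κ hκ
          simpa only [JKM.AlfeldSplit.dofNN, hcomm] using this
    have hNT : ∀ i, A.traceNT ω i = A.traceNT ω' i := fun i =>
      A.eq_of_integral_inner_eq (A.RF i) (fun _ => A.continuous_of_mem_RF)
        (hω.2.2 i) (hω'.2.2 i) (h2 i)
    have := A.traces_injective (a₁ := ⟨ω, hω⟩) (a₂ := ⟨ω', hω'⟩)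
      (Prod.ext (funext fun i => Subtype.ext (hNN i)) (funext fun i => Subtype.ext (hNT i)))
    exact congrArg Subtype.val this
  · intro f g
    choose κ hκ using fun i => JKM.AlfeldSplit.exists_integral_inner_eq (A.surface i) (A.P1 i)
      (fun _ => A.continuous_of_mem_P1) (f i)
    choose ρ hρ using fun i => JKM.AlfeldSplit.exists_integral_inner_eq (A.surface i) (A.RF i)
      (fun _ => A.continuous_of_mem_RF) (g i)
    obtain ⟨ω, hω, h⟩ := A.exists_mem_SigmaR κ ρ
    refine ⟨ω, hω, fun i η => ?_, fun i η => ?_⟩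
    · rw [← hκ i η, JKM.AlfeldSplit.dofNN, (h i).1]
      simp only [hcomm]
    · rw [← hρ i η, JKM.AlfeldSplit.dofNT, (h i).2]
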